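/- Let $M$ be a smooth manifold of dimension $2n+1$ and let $\eta$ be a contact form on $M$, that is, a smooth $1$-form such that $\eta\wedge(d\eta)^n$ vanishes nowhere. Let $\mathcal R$ be its Reeb vector field ($\eta(\mathcal R)=1$, $d\eta(\mathcal R,\cdot)=0$), let $\flat_x:T_xM\to T_x^*M$, $\flat_x(v)=d\eta(v,\cdot)+\eta(v)\eta$, let $\sharp=\flat^{-1}$, and let $\sharp_\Lambda(\alpha)=\sharp(\alpha)-\alpha(\mathcal R)\mathcal R$. The Hamiltonian vector field of a smooth function $H:M\to\mathbb R$ is $X_H=\sharp_\Lambda(dH)-H\mathcal R$. A submanifold $N\subseteq M$ is called Legendrian if $T_pN=\sharp_\Lambda\big((T_pN)^\circ\big)$ for every $p\in N$, where $(T_pN)^\circ\subseteq T_p^*M$ is the annihilator of $T_pN$; the same definition is used for every contact manifold. On $TM\times\mathbb R$, with $t$ the coordinate of $\mathbb R$, consider the $1$-form $\bar\eta=\eta^c+t\,\eta^v$, where $\eta^c$ and $\eta^v$ are the complete and vertical lifts of $\eta$ to $TM$; in the coordinates $(x^i,\dot x^i)$ of $TM$ induced by coordinates $(x^i)$ of $M$,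 if $\eta=\eta_i\,dx^i$, then $\eta^c=\dot x^k\,\partial_k\eta_i\,dx^i+\eta_i\,d\dot x^i$ and $\eta^v=\eta_i\,dx^i$. Then $(TM\times\mathbb R,\bar\eta)$ is a contact manifold. Moreover, let $X$ be a smooth vector field on $M$ and define $$\bar X=X\times\big(-\mathcal R(\eta(X))\big):M\to TM\times\mathbb R,\qquad p\mapsto\big(X_p,\,-\mathcal R(\eta(X))(p)\big).$$ Then $X=X_H$ for some smooth function $H:M\to\mathbb R$ if and only if the image of $\bar X$ is a Legendrian submanifold of $(TM\times\mathbb R,\bar\eta)$. -/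

import Mathlib

open Set Topology Bundle
open scoped Manifold ContDiff

noncomputable section

namespace Contact

/-! ### One-forms on a manifold and their exterior derivative -/

section Forms

variable {E : Type*} [NormedAddCommGroup E] [NormedSpace ℝ E]
  {H : Type*} [TopologicalSpace H] (I : ModelWithCorners ℝ E H)
  {M : Type*} [TopologicalSpace M] [ChartedSpace H M]

/-- A (not necessarily smooth) vector field on `M`. -/
abbrev VectorField (M : Type*) [TopologicalSpace M] [ChartedSpace H M] : Type _ :=
  ∀ x : M, TangentSpace I x

/-- A (not necessarily smooth) one-form on `M`. -/
abbrev OneForm (M : Type*) [TopologicalSpace M] [ChartedSpace H M] : Type _ :=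
  ∀ x : M, TangentSpace I x →L[ℝ] ℝ

/-- The vector field `X` is smooth: it is a smooth section of the tangent bundle. -/
def IsSmoothField [IsManifold I 1 M] (X : VectorField I M) : Prop :=
  ContMDiff I I.tangent ∞ (fun x ↦ (⟨x, X x⟩ : TangentBundle I M))

/-- The one-form `η` is smooth: it is a smooth section of the cotangent bundle, the bundle of
continuous linear maps from the tangent bundle to the trivial line bundle. -/
def IsSmoothForm [IsManifold I 1 M] (η : OneForm I M) : Prop :=
  ContMDiff I (I.prod 𝓘(ℝ, E →L[ℝ] ℝ)) ∞
    (fun x ↦ TotalSpace.mk' (E →L[ℝ] ℝ)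
      (E := fun x : M ↦ TangentSpace I x →L[ℝ] Bundle.Trivial M ℝ x) x (η x))

/-- The expression of the one-form `η` in the preferred chart `φ` around `x₀`, that is the
pullback of `η` by `φ⁻¹`. -/
def formInChart (η : OneForm I M) (x₀ : M) (y : E) : E →L[ℝ] ℝ :=
  (η ((extChartAt I x₀).symm y)).comp
    (mfderivWithin 𝓘(ℝ, E) I (extChartAt I x₀).symm (range I) y)

/-- The exterior derivative of the chart expression of `η` around `x₀`, at the image of `x₀`:
the bilinear form `(u, v) ↦ D_u α (v) - D_v α (u)` on the model space. -/
def extDerivInChart (η : OneForm I M) (x₀ : M) : E →L[ℝ] E →L[ℝ] ℝ :=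
  fderivWithin ℝ (formInChart I η x₀) (range I) (extChartAt I x₀ x₀) -
    (fderivWithin ℝ (formInChart I η x₀) (range I) (extChartAt I x₀ x₀)).flip

/-- The exterior derivative `dη` of a one-form at `x`: computed in the preferred chart `φ` around
`x` and pulled back by `φ`. The convention is
`dη(X, Y) = X(η(Y)) - Y(η(X)) - η([X, Y])`. -/
def extDerivForm (η : OneForm I M) (x : M) :
    TangentSpace I x →L[ℝ] TangentSpace I x →L[ℝ] ℝ :=
  let L : TangentSpace I x →L[ℝ] E := mfderiv I 𝓘(ℝ, E) (extChartAt I x) x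
  (ContinuousLinearMap.precomp ℝ L).comp ((extDerivInChart I η x).comp L)

end Forms

/-! ### Contact forms -/

/-- The value of `a ∧ bⁿ` (`a` a one-form and `b` a two-form on a vector space `V`) on a family of
`2n+1` vectors, where
`(a ∧ bⁿ)(v) = 2⁻ⁿ ∑_σ sgn(σ) a(v_{σ(0)}) b(v_{σ(1)}, v_{σ(2)}) ⋯ b(v_{σ(2n-1)}, v_{σ(2n)})`.
The `2n+1` slots are indexed as follows: `none` is the slot of `a`, and `some (i, 0)`,
`some (i, 1)` are the two slots of the `i`-th factor `b`. -/
def wedgePow {V : Type*} (a : V → ℝ) (b : V → V → ℝ) (n : ℕ)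
    (v : Option (Fin n × Fin 2) → V) : ℝ :=
  (2 ^ n : ℝ)⁻¹ * ∑ σ : Equiv.Perm (Option (Fin n × Fin 2)),
    ((Equiv.Perm.sign σ : ℤ) : ℝ) *
      (a (v (σ none)) * ∏ i : Fin n, b (v (σ (some (i, 0)))) (v (σ (some (i, 1)))))

section ContactForms

variable {E : Type*} [NormedAddCommGroup E] [NormedSpace ℝ E]
  {H : Type*} [TopologicalSpace H] (I : ModelWithCorners ℝ E H)
  {M : Type*} [TopologicalSpace M] [ChartedSpace H M]

/-- `η` is a contact form on `M`: for some `n`, the manifold `M` has dimension `2n+1`, `η` is a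
smooth one-form, and `η ∧ (dη)ⁿ` does not vanish at any point. -/
def IsContactForm [IsManifold I 1 M] (η : OneForm I M) : Prop :=
  IsSmoothForm I η ∧ ∃ n : ℕ, Module.finrank ℝ E = 2 * n + 1 ∧
    ∀ x : M, ∃ v : Option (Fin n × Fin 2) → TangentSpace I x,
      wedgePow (fun u ↦ η x u) (fun u w ↦ extDerivForm I η x u w) n v ≠ 0

/-- The map `♭ : T_x M → T_x^* M`, `v ↦ dη(v, ·) + η(v) η`. -/
def flat (η : OneForm I M) (x : M) :
    TangentSpace I x →L[ℝ] (TangentSpace I x →L[ℝ] ℝ) :=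
  extDerivForm I η x + (η x).smulRight (η x)

/-- The map `♯ = ♭⁻¹ : T_x^* M → T_x M` (by convention zero if `♭` is not invertible, which does
not happen for a contact form). -/
def sharp (η : OneForm I M) (x : M) :
    (TangentSpace I x →L[ℝ] ℝ) →L[ℝ] TangentSpace I x :=
  (flat I η x).inverse

/-- The Reeb vector field: `reeb x` is the vector `R` in `T_x M`, unique for a contact form, with
`η(R) = 1` and `dη(R, ·) = 0`. -/
def reeb (η : OneForm I M) : VectorField I M := fun x ↦
  Classical.epsilon fun R : TangentSpace I x ↦
    η x R = 1 ∧ ∀ w : TangentSpace I x, extDerivForm I η x R w = 0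

/-- The map `♯_Λ : T_x^* M → T_x M` of the Jacobi structure of a contact form,
`♯_Λ(α) = ♯(α) - α(R) R`. It is the map `α ↦ Λ(α, ·)` for the bivector
`Λ(α, β) = -dη(♯α, ♯β)`. -/
def sharpLambda (η : OneForm I M) (x : M) (α : TangentSpace I x →L[ℝ] ℝ) : TangentSpace I x :=
  sharp I η x α - α (reeb I η x) • reeb I η x

/-- The contact complement `♯_Λ(Δ°)` of `Δ ⊆ T_x M`, where `Δ°` is the annihilator of `Δ`. -/
def contactComplement (η : OneForm I M) (x : M) (Δ : Set (TangentSpace I x)) :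
    Set (TangentSpace I x) :=
  sharpLambda I η x '' {α | ∀ v ∈ Δ, α v = 0}

/-- The derivative `Y(f)` of the function `f` along the vector field `Y`. -/
def dirDeriv (Y : VectorField I M) (f : M → ℝ) (x : M) : ℝ :=
  mfderiv I 𝓘(ℝ, ℝ) f x (Y x)

/-- The contact Hamiltonian vector field `X_F = ♯_Λ(dF) - F R` of the function `F`. -/
def hamiltonianField (η : OneForm I M) (F : M → ℝ) : VectorField I M := fun x ↦
  sharpLambda I η x (mfderiv I 𝓘(ℝ, ℝ) F x) - F x • reeb I η x

/-- `X` is a contact Hamiltonian vector field: it is `X_F` for some smooth function `F`. -/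
def IsHamiltonianField (η : OneForm I M) (X : VectorField I M) : Prop :=
  ∃ F : M → ℝ, ContMDiff I 𝓘(ℝ, ℝ) ∞ F ∧ X = hamiltonianField I η F

/-! ### Submanifolds -/

/-- `N` is an (embedded, smooth) submanifold of `M`: around each of its points there is a chart of
the smooth structure of `M` in which `N` is a linear subspace of the model space. -/
def IsSubmanifold (N : Set M) : Prop :=
  ∀ p ∈ N, ∃ φ ∈ IsManifold.maximalAtlas I ∞ M, p ∈ φ.source ∧
    ∃ S : Submodule ℝ E, ∀ q ∈ φ.source, q ∈ N ↔ φ.extend I q ∈ S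

/-- The tangent space `T_p N` of a submanifold `N`, inside `T_p M`: the velocities at time `0` of
the smooth curves through `p` that lie in `N`. -/
def tangentSpaceOf (N : Set M) (p : M) : Set (TangentSpace I p) :=
  {v | ∃ γ : ℝ → M, γ 0 = p ∧ ContMDiffAt 𝓘(ℝ, ℝ) I ∞ γ 0 ∧ (∀ᶠ t in 𝓝 (0 : ℝ), γ t ∈ N) ∧
    (mfderiv 𝓘(ℝ, ℝ) I γ 0 (1 : ℝ) : E) = (v : E)}

/-- `N` is a Legendrian submanifold of `(M, η)`: a submanifold whose tangent spaces are equal to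
their contact complements. -/
def IsLegendrian (η : OneForm I M) (N : Set M) : Prop :=
  IsSubmanifold I N ∧
    ∀ p ∈ N, tangentSpaceOf I N p = contactComplement I η p (tangentSpaceOf I N p)

end ContactForms

/-! ### Lifts to the tangent bundle -/

section Lifts

variable {E : Type*} [NormedAddCommGroup E] [NormedSpace ℝ E]
  {H : Type*} [TopologicalSpace H] (I : ModelWithCorners ℝ E H)
  {M : Type*} [TopologicalSpace M] [ChartedSpace H M] [IsManifold I 1 M]

/-- The differential at `v` of the projection `τ : TM → M`. -/
def dproj (v : TangentBundle I M) : TangentSpace I.tangent v →L[ℝ] TangentSpace I v.proj :=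
  mfderiv I.tangent I (fun w : TangentBundle I M ↦ w.proj) v

/-- The vertical lift `η^v = τ^* η` of a one-form to the tangent bundle. -/
def verticalLift (η : OneForm I M) : OneForm I.tangent (TangentBundle I M) := fun v ↦
  (η v.proj).comp (dproj I v)

/-- The complete lift `η^c` of a one-form to the tangent bundle. It is written invariantly as
`η^c_v = (d η̂)_v + dη(v, dτ(·))`, where `η̂ : TM → ℝ` is the function `v ↦ η(v)`. In the
coordinates `(xⁱ, ẋⁱ)` of `TM` induced by coordinates `(xⁱ)` of `M`, this is
`(η_i dxⁱ)^c = ẋᵏ (∂_k η_i) dxⁱ + η_i dẋⁱ`. -/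
def completeLift (η : OneForm I M) : OneForm I.tangent (TangentBundle I M) := fun v ↦
  let dη_hat : TangentSpace I.tangent v →L[ℝ] ℝ :=
    mfderiv I.tangent 𝓘(ℝ, ℝ) (fun w : TangentBundle I M ↦ η w.proj w.snd) v
  dη_hat + (extDerivForm I η v.proj v.snd).comp (dproj I v)

/-- The one-form `η^c + t η^v` on `TM × ℝ`, where `t` is the coordinate of `ℝ` and the lifts are
pulled back to the product. -/
def extendedForm (η : OneForm I M) :
    OneForm (I.tangent.prod 𝓘(ℝ, ℝ)) (TangentBundle I M × ℝ) := fun p ↦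
  (completeLift I η p.1 + p.2 • verticalLift I η p.1).comp
    (mfderiv (I.tangent.prod 𝓘(ℝ, ℝ)) I.tangent
      (Prod.fst : TangentBundle I M × ℝ → TangentBundle I M) p)

/-- The extended vector field `X̄ = X × (-R(η(X))) : M → TM × ℝ`. -/
def extendedField (η : OneForm I M) (X : VectorField I M) (x : M) : TangentBundle I M × ℝ :=
  (⟨x, X x⟩, -dirDeriv I (reeb I η) (fun y ↦ η y (X y)) x)

end Lifts

end Contact

end

/-! The pullback of η^c + t η^v by X̄ is d(η(X)) + dη(X, ·) - R(η(X)) η, that is L_X η - R(η(X)) η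
(`val_extendedForm_extendedField`). Both sides of the equivalence say that this form vanishes.

On the Hamiltonian side, X = X_F means η(X) = -F and dη(X, ·) = dF - R(F) η. The first equation
forces F = -η(X), and the second is then L_X η = R(η(X)) η (`isHamiltonianField_iff`).

On the Legendrian side, X̄ is a section of TM × ℝ → M, so its image is a submanifold of dimension
2n+1 inside a contact manifold of dimension 2(2n+1)+1, with tangent spaces the ranges of the
differential of X̄. Every contact complement lies in the kernel of the contact form, so a Legendrian
image makes the pullback vanish. Conversely, if the pullback of the form vanishes, so does the
pullback of its exterior derivative; the tangent spaces are then isotropic of half the maximal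
dimension, and a dimension count shows that they equal their contact complements
(`contactComplement_eq`, `isLegendrian_range_iff`).

That TM × ℝ is contact is a pointwise statement. In dimension 2n+1, for b alternating, a ∧ bⁿ ≠ 0 is
equivalent to ker a ∩ ker b = 0 (`nondeg_of_wedgePow_ne_zero`, `Nondeg.exists_wedgePow_ne_zero`).
The second condition is checked by hand on the coordinate expression of the extended form
(`formInChart_extendedForm`, `isLinContact_extForm`). -/

noncomputable section

namespace Contact

/-! ### Linear algebra of contact structures -/

section LinearAlgebra

variable {V : Type*} [AddCommGroup V] [Module ℝ V]

/-- The pair `(a, b)` is nondegenerate: the kernels of `a` and of `b` meet trivially. -/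
def Nondeg (a : V →ₗ[ℝ] ℝ) (b : V →ₗ[ℝ] V →ₗ[ℝ] ℝ) : Prop :=
  ∀ v, a v = 0 → (∀ w, b v w = 0) → v = 0

/-- The multilinear map `v ↦ a(v_none) ∏ b(v_(i,0), v_(i,1))`, whose alternatization is
`2ⁿ • a ∧ bⁿ`. -/
def wedgeMap (a : V →ₗ[ℝ] ℝ) (b : V →ₗ[ℝ] V →ₗ[ℝ] ℝ) (n : ℕ) :
    MultilinearMap ℝ (fun _ : Option (Fin n × Fin 2) ↦ V) ℝ :=
  MultilinearMap.mk'
    (fun v ↦ a (v none) * ∏ i : Fin n, b (v (some (i, 0))) (v (some (i, 1))))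
    (by
      rintro v (_ | ⟨j, k⟩) x y
      · simp [Function.update_of_ne, add_mul]
      · simp only [← Finset.mul_prod_erase _ _ (Finset.mem_univ j)]
        have h : ∀ z : V, ∏ i ∈ Finset.univ.erase j,
            b (Function.update v (some (j, k)) z (some (i, 0)))
              (Function.update v (some (j, k)) z (some (i, 1))) =
            ∏ i ∈ Finset.univ.erase j, b (v (some (i, 0))) (v (some (i, 1))) := by
          intro z
          refine Finset.prod_congr rfl fun i hi ↦ ?_
          have hij : i ≠ j := Finset.ne_of_mem_erase hi
          simp [Function.update_of_ne, hij]
        simp only [h]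
        fin_cases k <;> simp [Function.update_of_ne] <;> ring)
    (by
      rintro v (_ | ⟨j, k⟩) c x
      · simp [Function.update_of_ne, mul_assoc]
      · simp only [← Finset.mul_prod_erase _ _ (Finset.mem_univ j)]
        have h : ∀ z : V, ∏ i ∈ Finset.univ.erase j,
            b (Function.update v (some (j, k)) z (some (i, 0)))
              (Function.update v (some (j, k)) z (some (i, 1))) =
            ∏ i ∈ Finset.univ.erase j, b (v (some (i, 0))) (v (some (i, 1))) := by
          intro z
          refine Finset.prod_congr rfl fun i hi ↦ ?_
          have hij : i ≠ j := Finset.ne_of_mem_erase hi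
          simp [Function.update_of_ne, hij]
        simp only [h]
        fin_cases k <;> simp [Function.update_of_ne] <;> ring)

theorem wedgeMap_apply (a : V →ₗ[ℝ] ℝ) (b : V →ₗ[ℝ] V →ₗ[ℝ] ℝ) (n : ℕ)
    (v : Option (Fin n × Fin 2) → V) :
    wedgeMap a b n v = a (v none) * ∏ i : Fin n, b (v (some (i, 0))) (v (some (i, 1))) := rfl

theorem wedgePow_eq_alternatization (a : V →ₗ[ℝ] ℝ) (b : V →ₗ[ℝ] V →ₗ[ℝ] ℝ) (n : ℕ)
    (v : Option (Fin n × Fin 2) → V) :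
    wedgePow (fun u ↦ a u) (fun u w ↦ b u w) n v =
      (2 ^ n : ℝ)⁻¹ * MultilinearMap.alternatization (wedgeMap a b n) v := by
  rw [wedgePow, MultilinearMap.alternatization_apply]
  congr 1
  refine Finset.sum_congr rfl fun σ _ ↦ ?_
  rw [Units.smul_def, zsmul_eq_mul, MultilinearMap.domDomCongr_apply, wedgeMap_apply]

/-- Whatever slot the vector occupies, the one factor that contains it vanishes. -/
theorem wedgeMap_eq_zero_of_mem_radical {a : V →ₗ[ℝ] ℝ} {b : V →ₗ[ℝ] V →ₗ[ℝ] ℝ}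
    (hb : ∀ u w, b u w = -b w u) {n : ℕ} {v : Option (Fin n × Fin 2) → V}
    (i : Option (Fin n × Fin 2)) (ha : a (v i) = 0) (hi : ∀ w, b (v i) w = 0) :
    wedgeMap a b n v = 0 := by
  rw [wedgeMap_apply]
  rcases i with _ | ⟨j, k⟩
  · rw [ha, zero_mul]
  · rw [Finset.prod_eq_zero (Finset.mem_univ j), mul_zero]
    fin_cases k
    · exact hi _
    · rw [hb]; simpa using hi _

/-- If `a ∧ bⁿ` is a nonzero form of top degree, then `(a, b)` is nondegenerate. -/
theorem nondeg_of_wedgePow_ne_zero {a : V →ₗ[ℝ] ℝ} {b : V →ₗ[ℝ] V →ₗ[ℝ] ℝ}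
    (hb : ∀ u w, b u w = -b w u) {n : ℕ} (hn : Module.finrank ℝ V = 2 * n + 1)
    {v : Option (Fin n × Fin 2) → V}
    (hv : wedgePow (fun u ↦ a u) (fun u w ↦ b u w) n v ≠ 0) : Nondeg a b := by
  intro u hau hbu
  set f := MultilinearMap.alternatization (wedgeMap a b n) with hf
  have hfv : f v ≠ 0 := by
    intro h
    exact hv (by rw [wedgePow_eq_alternatization, ← hf, h, mul_zero])
  have hli : LinearIndependent ℝ v := by
    by_contra h
    exact hfv (f.map_linearDependent v h)
  have hcard : Fintype.card (Option (Fin n × Fin 2)) = Module.finrank ℝ V := by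
    simp [hn]; ring
  let B := basisOfLinearIndependentOfCardEqFinrank hli hcard
  have hB : ∀ i, B i = v i := fun i ↦ by simp [B]
  -- The vector u lies in both kernels, so inserting it in any slot kills every term. Since f is
  -- nonzero on the basis v, inserting u in slot i also reads off the i-th coordinate of u.
  have hzero : ∀ i, f (Function.update v i u) = 0 := by
    intro i
    rw [hf, MultilinearMap.alternatization_apply]
    refine Finset.sum_eq_zero fun σ _ ↦ ?_
    rw [MultilinearMap.domDomCongr_apply, wedgeMap_eq_zero_of_mem_radical hb (σ.symm i), smul_zero]
    · simpa using hau
    · simpa using hbu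
  have hrepr : ∀ i, B.repr u i = 0 := by
    intro i
    have h1 : f (Function.update v i u) = B.repr u i * f v := by
      conv_lhs => rw [← B.sum_repr u]
      rw [AlternatingMap.map_update_sum, Finset.sum_eq_single i]
      · rw [AlternatingMap.map_update_smul, hB, Function.update_eq_self, smul_eq_mul]
      · intro j _ hj
        rw [AlternatingMap.map_update_smul, hB, AlternatingMap.map_update_self _ _ hj.symm,
          smul_zero]
      · simp
    rw [hzero] at h1
    exact (mul_eq_zero.1 h1.symm).resolve_right hfv
  rw [← B.sum_repr u]
  simp [hrepr]

/-- A nondegenerate alternating form has a symplectic basis. -/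
theorem exists_symplectic_family (m : ℕ) : ∀ {W : Type _} [AddCommGroup W] [Module ℝ W]
    [FiniteDimensional ℝ W] (b : W →ₗ[ℝ] W →ₗ[ℝ] ℝ), Module.finrank ℝ W = m →
    (∀ u w, b u w = -b w u) → (∀ v, (∀ w, b v w = 0) → v = 0) →
    ∃ n : ℕ, m = 2 * n ∧ ∃ e f : Fin n → W, (∀ i j, b (e i) (f j) = if i = j then 1 else 0) ∧
      (∀ i j, b (e i) (e j) = 0) ∧ ∀ i j, b (f i) (f j) = 0 := by
  induction m using Nat.strong_induction_on with
  | _ m ih =>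
    intro W _ _ _ b hm hb hnd
    have hself : ∀ w, b w w = 0 := fun w ↦ by linarith [hb w w]
    rcases Nat.eq_zero_or_pos m with rfl | hpos
    · exact ⟨0, rfl, Fin.elim0, Fin.elim0, fun i ↦ i.elim0, fun i ↦ i.elim0, fun i ↦ i.elim0⟩
    have : Nontrivial W := Module.nontrivial_of_finrank_pos (R := ℝ) (by omega)
    obtain ⟨x, hx⟩ := exists_ne (0 : W)
    obtain ⟨y, hxy⟩ : ∃ y, b x y = 1 := by
      have : ∃ z, b x z ≠ 0 := by
        by_contra! h
        exact hx (hnd x h)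
      obtain ⟨z, hz⟩ := this
      exact ⟨(b x z)⁻¹ • z, by simp [hz]⟩
    have hyx : b y x = -1 := by rw [hb, hxy]
    -- The kernel of L is the b-orthogonal complement of the hyperbolic plane spanned by x and y; it
    -- has dimension m - 2, and the induction continues there.
    let L : W →ₗ[ℝ] ℝ × ℝ := (b x).prod (b y)
    have hker : ∀ w : L.ker, b x w = 0 ∧ b y w = 0 := fun w ↦ by
      have := w.2
      rw [LinearMap.mem_ker] at this
      exact ⟨congrArg Prod.fst this, congrArg Prod.snd this⟩
    have hsurj : Function.Surjective L := by
      rintro ⟨s, t⟩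
      refine ⟨s • y - t • x, ?_⟩
      simp [L, hself, hxy, hyx]
    have hdim := L.finrank_range_add_finrank_ker
    rw [LinearMap.range_eq_top.2 hsurj, finrank_top, hm] at hdim
    simp at hdim
    obtain ⟨n, hn, e, f, hef, hee, hff⟩ := ih (Module.finrank ℝ L.ker) (by omega)
      (b.domRestrict₁₂ L.ker L.ker) rfl (fun u w ↦ hb _ _) (by
        intro v hv
        apply Subtype.ext
        apply hnd
        intro w
        -- Projection of w to the orthogonal complement: a vector of the complement orthogonal to
        -- the complement is orthogonal to everything.
        have hw : w - b x w • y + b y w • x ∈ L.ker := by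
          rw [LinearMap.mem_ker]
          simp [L, hself, hxy, hyx]
        have : b v (w - b x w • y + b y w • x) = 0 := hv ⟨_, hw⟩
        have h1 : b v y = 0 := by rw [hb, (hker v).2, neg_zero]
        have h2 : b v x = 0 := by rw [hb, (hker v).1, neg_zero]
        simpa [h1, h2] using this)
    refine ⟨n + 1, by omega, Fin.cons x fun i ↦ e i, Fin.cons y fun i ↦ f i, ?_, ?_, ?_⟩
    · refine Fin.cases (Fin.cases (by simp [hxy]) fun j ↦ ?_) fun i ↦ Fin.cases ?_ fun j ↦ ?_
      · simpa [(Fin.succ_ne_zero j).symm] using (hker (f j)).1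
      · rw [hb]; simpa using (hker (e i)).2
      · simp only [Fin.cons_succ, Fin.succ_inj]
        exact hef i j
    · refine Fin.cases (Fin.cases (by simp [hself]) fun j ↦ ?_) fun i ↦ Fin.cases ?_ fun j ↦ ?_
      · simpa using (hker (e j)).1
      · rw [hb]; simpa using (hker (e i)).1
      · simp only [Fin.cons_succ]
        exact hee i j
    · refine Fin.cases (Fin.cases (by simp [hself]) fun j ↦ ?_) fun i ↦ Fin.cases ?_ fun j ↦ ?_
      · simpa using (hker (f j)).2
      · rw [hb]; simpa using (hker (f i)).2
      · simp only [Fin.cons_succ]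
        exact hff i j

/-- In odd dimension, a nondegenerate pair has a Reeb vector. -/
theorem Nondeg.exists_reeb [FiniteDimensional ℝ V] {a : V →ₗ[ℝ] ℝ} {b : V →ₗ[ℝ] V →ₗ[ℝ] ℝ}
    (h : Nondeg a b) (hb : ∀ u w, b u w = -b w u) {n : ℕ}
    (hn : Module.finrank ℝ V = 2 * n + 1) : ∃ R, a R = 1 ∧ ∀ w, b R w = 0 := by
  obtain ⟨v, hv, hv0⟩ : ∃ v, (∀ w, b v w = 0) ∧ v ≠ 0 := by
    -- If b had no radical, a symplectic basis would make the dimension even.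
    by_contra! hnd
    obtain ⟨k, hk, -⟩ := exists_symplectic_family _ b hn hb hnd
    omega
  have hav : a v ≠ 0 := fun h0 ↦ hv0 (h v h0 hv)
  exact ⟨(a v)⁻¹ • v, by simp [hav], fun w ↦ by simp [hv]⟩

/-- Such a σ is two disjoint copies of one permutation of `Fin n`, so its sign is a square. -/
theorem sign_eq_one_of_map_pairs {n : ℕ} (σ : Equiv.Perm (Option (Fin n × Fin 2)))
    (h0 : σ none = none) (q : Fin n → Fin n) (h : ∀ i k, σ (some (i, k)) = some (q i, k)) :
    Equiv.Perm.sign σ = 1 := by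
  have hinj : Function.Injective q := by
    intro i j hij
    have : σ (some (i, 0)) = σ (some (j, 0)) := by rw [h, h, hij]
    simpa using σ.injective this
  let p : Equiv.Perm (Fin n) := Equiv.ofBijective q hinj.bijective_of_finite
  have hσ : σ = Equiv.optionCongr (Equiv.prodCongrLeft fun _ : Fin 2 ↦ p) := by
    ext1 x
    rcases x with _ | ⟨i, k⟩
    · simp [h0]
    · simp [h, p]
  rw [hσ, Equiv.optionCongr_sign, Equiv.Perm.sign_prodCongrLeft]
  simp

/-- The value `J p q` of the standard symplectic form on the standard basis of `ℝ²`. -/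
def stdSymp (p q : Fin 2) : ℝ := if p = q then 0 else if p = 0 then 1 else -1

/-- On a Reeb vector followed by a symplectic basis, a nonzero term comes from a σ that fixes
`none`, permutes the symplectic pairs, and possibly flips some of them. Permuting whole pairs is
even, and each flip changes both the sign of σ and one factor of the product, so the signs cancel.
-/
theorem wedgeMap_term_nonneg {a : V →ₗ[ℝ] ℝ} {b : V →ₗ[ℝ] V →ₗ[ℝ] ℝ} {n : ℕ}
    {v : Option (Fin n × Fin 2) → V} (h0 : a (v none) = 1) (h1 : ∀ p, a (v (some p)) = 0)
    (hR : ∀ w, b (v none) w = 0) (hR' : ∀ w, b w (v none) = 0)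
    (hv : ∀ p q, b (v (some p)) (v (some q)) = if p.1 = q.1 then stdSymp p.2 q.2 else 0)
    (σ : Equiv.Perm (Option (Fin n × Fin 2))) :
    0 ≤ ((Equiv.Perm.sign σ : ℤ) : ℝ) * wedgeMap a b n (v ∘ σ) := by
  by_cases hz : wedgeMap a b n (v ∘ σ) = 0
  · rw [hz, mul_zero]
  rw [wedgeMap_apply] at hz
  have hσ0 : σ none = none := by
    rcases hs : σ none with _ | p
    · rfl
    · exact absurd (by simp [hs, h1]) hz
  have key : ∀ i, ∃ (j : Fin n) (ε : Equiv.Perm (Fin 2)),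
      (∀ k, σ (some (i, ε k)) = some (j, k)) ∧
      b (v (σ (some (i, 0)))) (v (σ (some (i, 1)))) = ((Equiv.Perm.sign ε : ℤ) : ℝ) := by
    intro i
    have hi : b (v (σ (some (i, 0)))) (v (σ (some (i, 1)))) ≠ 0 := by
      intro h
      exact hz (by rw [Finset.prod_eq_zero (Finset.mem_univ i) h, mul_zero])
    rcases hs : σ (some (i, 0)) with _ | ⟨j, k⟩
    · simp [hs, hR] at hi
    rcases ht : σ (some (i, 1)) with _ | ⟨j', k'⟩
    · simp [ht, hR'] at hi
    rw [hs, ht, hv] at hi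
    have hj : j = j' := by
      by_contra hne
      simp [hne] at hi
    subst hj
    rw [hv]
    fin_cases k <;> fin_cases k' <;> simp [stdSymp] at hi ⊢
    · refine ⟨j, Equiv.refl _, ?_, by simp⟩
      exact ⟨hs, ht⟩
    · refine ⟨j, Equiv.swap 0 1, ?_, by simp⟩
      exact ⟨by simpa using ht, by simpa using hs⟩
  choose q ε hq hε using key
  -- Precomposing with τ undoes the flips and leaves a permutation of whole pairs.
  let τ : Equiv.Perm (Option (Fin n × Fin 2)) := Equiv.optionCongr (Equiv.prodCongrRight ε)
  have hsign : Equiv.Perm.sign (σ * τ) = 1 := by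
    refine sign_eq_one_of_map_pairs _ (by simp [τ, hσ0]) q fun i k ↦ ?_
    simp [τ, hq]
  have hτ : Equiv.Perm.sign τ = ∏ i, Equiv.Perm.sign (ε i) := by
    simp only [τ, Equiv.optionCongr_sign, Equiv.Perm.sign_prodCongrRight]
  rw [Equiv.Perm.sign_mul, hτ] at hsign
  have hprod : wedgeMap a b n (v ∘ σ) = ((∏ i, Equiv.Perm.sign (ε i) : ℤˣ) : ℤ) := by
    rw [wedgeMap_apply]
    simp only [Function.comp_apply, hσ0, h0, one_mul, hε]
    push_cast
    rfl
  rw [hprod, ← Int.cast_mul, ← Units.val_mul, hsign]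
  simp

/-- If `(a, b)` is nondegenerate on a space of dimension `2n+1`, then `a ∧ bⁿ` is not zero. -/
theorem Nondeg.exists_wedgePow_ne_zero [FiniteDimensional ℝ V]
    {a : V →ₗ[ℝ] ℝ} {b : V →ₗ[ℝ] V →ₗ[ℝ] ℝ} (h : Nondeg a b) (hb : ∀ u w, b u w = -b w u)
    {n : ℕ} (hn : Module.finrank ℝ V = 2 * n + 1) :
    ∃ v, wedgePow (fun u ↦ a u) (fun u w ↦ b u w) n v ≠ 0 := by
  obtain ⟨R, haR, hbR⟩ := h.exists_reeb hb hn
  have hbR' : ∀ w, b w R = 0 := fun w ↦ by rw [hb, hbR, neg_zero]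
  have hsurj : Function.Surjective a := fun t ↦ ⟨t • R, by simp [haR]⟩
  have hdim := a.finrank_range_add_finrank_ker
  rw [LinearMap.range_eq_top.2 hsurj, finrank_top, hn] at hdim
  simp only [Module.finrank_self] at hdim
  obtain ⟨k, hk, e, f, hef, hee, hff⟩ := exists_symplectic_family _
    (b.domRestrict₁₂ a.ker a.ker) (by omega : _ = 2 * n) (fun u w ↦ hb _ _) (by
      intro v hv
      refine Subtype.ext (h v v.2 fun w ↦ ?_)
      have : b v (w - a w • R) = 0 := hv ⟨w - a w • R, by simp [haR]⟩
      simpa [hbR'] using this)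
  obtain rfl : n = k := by omega
  simp only [LinearMap.domRestrict₁₂_apply] at hef hee hff
  let v : Option (Fin n × Fin 2) → V := fun o ↦
    o.elim R fun p ↦ if p.2 = 0 then (e p.1 : V) else f p.1
  have hvR : v none = R := rfl
  have hv0 : ∀ i, v (some (i, 0)) = e i := fun i ↦ rfl
  have hv1 : ∀ i, v (some (i, 1)) = f i := fun i ↦ rfl
  refine ⟨v, ?_⟩
  rw [wedgePow_eq_alternatization, MultilinearMap.alternatization_apply]
  refine mul_ne_zero (by positivity) (ne_of_gt ?_)
  -- No cancellation is possible: all terms are nonnegative and the identity contributes 1.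
  refine Finset.sum_pos' (fun σ _ ↦ ?_) ⟨1, Finset.mem_univ _, ?_⟩
  · rw [Units.smul_def, zsmul_eq_mul]
    refine wedgeMap_term_nonneg (a := a) (b := b) (v := v) (by rw [hvR, haR]) ?_
      (by simpa [hvR] using hbR) (by simpa [hvR] using hbR') ?_ σ
    · rintro ⟨i, k⟩
      fin_cases k
      · exact (e i).2
      · exact (f i).2
    · rintro ⟨i, k⟩ ⟨j, l⟩
      fin_cases k <;> fin_cases l <;> simp [stdSymp, hv0, hv1, hef, hee, hff]
      rw [hb, hef]
      simp [eq_comm, neg_ite]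
  · rw [Units.smul_def, zsmul_eq_mul, MultilinearMap.domDomCongr_apply, wedgeMap_apply]
    simp [hvR, hv0, hv1, haR, hef]

end LinearAlgebra

/-! ### Linear contact structures: the map ♭, the map ♯_Λ and isotropic subspaces. -/

section ContinuousLinearAlgebra

variable {V : Type*} [NormedAddCommGroup V] [NormedSpace ℝ V]

/-- The pair `(a, b)` is an odd-dimensional linear contact structure: `b` is alternating, there is
a Reeb vector, and the kernels of `a` and `b` meet trivially. -/
structure IsLinContact (a : V →L[ℝ] ℝ) (b : V →L[ℝ] V →L[ℝ] ℝ) : Prop where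
  antisymm : ∀ u w, b u w = -b w u
  nondeg : ∀ v, a v = 0 → (∀ w, b v w = 0) → v = 0
  exists_reeb : ∃ R, a R = 1 ∧ ∀ w, b R w = 0

variable {a : V →L[ℝ] ℝ} {b : V →L[ℝ] V →L[ℝ] ℝ}

theorem IsLinContact.self (h : IsLinContact a b) (u : V) : b u u = 0 := by
  linarith [h.antisymm u u]

/-- If ♭(v) = 0, evaluation at v gives a(v)² = 0, and then b(v, ·) = 0, so v = 0. Injectivity
suffices because V and its dual have equal dimension. -/
theorem IsLinContact.isInvertible_flat [FiniteDimensional ℝ V] (h : IsLinContact a b) :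
    (b + a.smulRight a).IsInvertible := by
  have hinj : Function.Injective (b + a.smulRight a) := by
    rw [injective_iff_map_eq_zero]
    intro v hv
    have hv' : ∀ w, b v w + a v * a w = 0 := fun w ↦ by
      simpa using congrArg (fun f : V →L[ℝ] ℝ ↦ f w) hv
    have h1 : a v = 0 := by simpa [h.self] using hv' v
    exact h.nondeg v h1 fun w ↦ by simpa [h1] using hv' w
  let e : V →ₗ[ℝ] Module.Dual ℝ V :=
    LinearMap.toContinuousLinearMap.symm.toLinearMap ∘ₗ (b + a.smulRight a).toLinearMap
  have he : Function.Injective e := LinearMap.toContinuousLinearMap.symm.injective.comp hinj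
  have hsurj : Function.Surjective (b + a.smulRight a) := by
    have := (LinearMap.injective_iff_surjective_of_finrank_eq_finrank
      (Subspace.dual_finrank_eq (K := ℝ) (V := V)).symm).1 he
    intro α
    obtain ⟨v, hv⟩ := this (LinearMap.toContinuousLinearMap.symm α)
    exact ⟨v, LinearMap.toContinuousLinearMap.symm.injective hv⟩
  exact ⟨(LinearEquiv.ofBijective (b + a.smulRight a).toLinearMap
    ⟨hinj, hsurj⟩).toContinuousLinearEquiv, by ext; rfl⟩

theorem IsLinContact.flat_inverse [FiniteDimensional ℝ V] (h : IsLinContact a b)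
    (α : V →L[ℝ] ℝ) (w : V) :
    b ((b + a.smulRight a).inverse α) w + a ((b + a.smulRight a).inverse α) * a w = α w := by
  have := h.isInvertible_flat.self_apply_inverse (y := α)
  simpa using congrArg (fun f : V →L[ℝ] ℝ ↦ f w) this

theorem IsLinContact.ext (h : IsLinContact a b) {u v : V} (ha : a u = a v)
    (hb : ∀ w, b u w = b v w) : u = v := by
  rw [← sub_eq_zero]
  exact h.nondeg _ (by simp [ha]) fun w ↦ by simp [hb]

theorem IsLinContact.right_reeb (h : IsLinContact a b) {R : V} (hR : ∀ w, b R w = 0) (w : V) :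
    b w R = 0 := by
  rw [h.antisymm, hR, neg_zero]

/-- `♯ α - α(R) R` is the vector `u` with `a(u) = 0` and `b(u, ·) = α - α(R) a`. -/
theorem IsLinContact.sharpLambda_spec [FiniteDimensional ℝ V] (h : IsLinContact a b)
    {R : V} (haR : a R = 1) (hR : ∀ w, b R w = 0) (α : V →L[ℝ] ℝ) (u : V) :
    u = (b + a.smulRight a).inverse α - α R • R ↔ a u = 0 ∧ ∀ w, b u w = α w - α R * a w := by
  set s := (b + a.smulRight a).inverse α with hs
  have hsw : ∀ w, b s w + a s * a w = α w := h.flat_inverse α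
  -- Evaluate ♭(s) = α at the Reeb vector.
  have has : a s = α R := by
    have := hsw R
    rwa [h.right_reeb hR, haR, zero_add, mul_one] at this
  have key : a (s - α R • R) = 0 ∧ ∀ w, b (s - α R • R) w = α w - α R * a w := by
    refine ⟨by simp [has, haR], fun w ↦ ?_⟩
    rw [← hsw w, has]
    simp [hR]
  constructor
  · rintro rfl
    exact key
  · rintro ⟨h1, h2⟩
    exact h.ext (h1.trans key.1.symm) fun w ↦ (h2 w).trans (key.2 w).symm

/-- An isotropic subspace of half the maximal dimension is its own contact complement. -/
theorem IsLinContact.mem_of_isotropic [FiniteDimensional ℝ V] (h : IsLinContact a b) {n : ℕ}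
    (hn : Module.finrank ℝ V = 2 * n + 1) (Δ : Submodule ℝ V) (hΔ : Module.finrank ℝ Δ = n)
    (ha : ∀ v ∈ Δ, a v = 0) (hb : ∀ v ∈ Δ, ∀ w ∈ Δ, b v w = 0) {u : V} (hau : a u = 0)
    (hbu : ∀ w ∈ Δ, b u w = 0) : u ∈ Δ := by
  obtain ⟨R, haR, hR⟩ := h.exists_reeb
  let e : V →ₗ[ℝ] Module.Dual ℝ V :=
    LinearMap.toContinuousLinearMap.symm.toLinearMap ∘ₗ (b + a.smulRight a).toLinearMap
  have he : Function.Injective e :=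
    LinearMap.toContinuousLinearMap.symm.injective.comp h.isInvertible_flat.injective
  have hew : ∀ v w, e v w = b v w + a v * a w := fun v w ↦ by simp [e]
  let Δ' : Submodule ℝ V := Δ ⊔ Submodule.span ℝ {R}
  let K : Submodule ℝ V := Δ ⊔ Submodule.span ℝ {u}
  have hK : ∀ v ∈ K, a v = 0 ∧ ∀ w ∈ Δ, b v w = 0 := by
    intro v hv
    obtain ⟨x, hx, y, hy, rfl⟩ := Submodule.mem_sup.1 hv
    obtain ⟨c, rfl⟩ := Submodule.mem_span_singleton.1 hy
    refine ⟨by simp [ha x hx, hau], fun w hw ↦ by simp [hb x hx w hw, hbu w hw]⟩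
  -- The injective map ♭ sends Δ + ⟨u⟩ into the annihilator of Δ + ⟨R⟩, whose dimension is (2n+1) -
  -- (n+1) = n because R is not in Δ. Hence Δ + ⟨u⟩ is no larger than Δ.
  have hmap : K.map e ≤ Δ'.dualAnnihilator := by
    rintro _ ⟨v, hv, rfl⟩
    rw [Submodule.mem_dualAnnihilator]
    intro w hw
    obtain ⟨x, hx, y, hy, rfl⟩ := Submodule.mem_sup.1 hw
    obtain ⟨c, rfl⟩ := Submodule.mem_span_singleton.1 hy
    simp [hew, (hK v hv).1, (hK v hv).2 x hx, h.right_reeb hR]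
  have h1 : Module.finrank ℝ K ≤ Module.finrank ℝ Δ'.dualAnnihilator := by
    rw [(Submodule.equivMapOfInjective e he K).finrank_eq]
    exact Submodule.finrank_mono hmap
  have h2 := Subspace.finrank_add_finrank_dualAnnihilator_eq Δ'
  have h3 : n < Module.finrank ℝ Δ' := by
    rw [← hΔ]
    refine Submodule.finrank_lt_finrank_of_lt (lt_of_le_of_ne le_sup_left fun heq ↦ ?_)
    have : R ∈ Δ := by
      rw [heq]
      exact Submodule.mem_sup_right (Submodule.mem_span_singleton_self R)
    simp [ha R this] at haR
  have h4 : Δ = K := Submodule.eq_of_le_of_finrank_le le_sup_left (by omega)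
  rw [h4]
  exact Submodule.mem_sup_right (Submodule.mem_span_singleton_self u)

end ContinuousLinearAlgebra

/-! ### The exterior derivative in charts -/

section ExteriorDerivative

variable {F : Type*} [NormedAddCommGroup F] [NormedSpace ℝ F]
  {E : Type*} [NormedAddCommGroup E] [NormedSpace ℝ E]

theorem two_le_infty : (2 : WithTop ℕ∞) ≤ ∞ := by
  exact WithTop.coe_le_coe.2 (le_top : (2 : ℕ∞) ≤ ⊤)

/-- The exterior derivative of a one-form on a vector space. -/
def dForm (α : E → E →L[ℝ] ℝ) (y : E) : E →L[ℝ] E →L[ℝ] ℝ :=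
  fderiv ℝ α y - (fderiv ℝ α y).flip

theorem dForm_apply (α : E → E →L[ℝ] ℝ) (y u v : E) :
    dForm α y u v = fderiv ℝ α y u v - fderiv ℝ α y v u := rfl

theorem dForm_antisymm (α : E → E →L[ℝ] ℝ) (y u v : E) : dForm α y u v = -dForm α y v u := by
  simp [dForm_apply]

theorem dForm_congr {α β : E → E →L[ℝ] ℝ} {y : E} (h : α =ᶠ[𝓝 y] β) : dForm α y = dForm β y := by
  rw [dForm, dForm, h.fderiv_eq]

/-- The exterior derivative commutes with pullbacks. -/
theorem dForm_pullback {ψ : F → E} {β : E → E →L[ℝ] ℝ} {y : F} (hψ : ContDiffAt ℝ ∞ ψ y)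
    (hβ : DifferentiableAt ℝ β (ψ y)) (u v : F) :
    dForm (fun z ↦ (β (ψ z)).comp (fderiv ℝ ψ z)) y u v =
      dForm β (ψ y) (fderiv ℝ ψ y u) (fderiv ℝ ψ y v) := by
  have h1 : DifferentiableAt ℝ ψ y := hψ.differentiableAt (by simp)
  have h2 : DifferentiableAt ℝ (fderiv ℝ ψ) y :=
    (hψ.fderiv_right (m := 1)
      (by rw [one_add_one_eq_two]; exact two_le_infty)).differentiableAt (by simp)
  have h3 := (hβ.hasFDerivAt.comp y h1.hasFDerivAt).clm_comp h2.hasFDerivAt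
  -- The second derivative of ψ contributes a symmetric term, which antisymmetrization removes.
  have hsymm : fderiv ℝ (fderiv ℝ ψ) y u v = fderiv ℝ (fderiv ℝ ψ) y v u :=
    (hψ.isSymmSndFDerivAt (by simpa using two_le_infty)) u v
  have h4 : fderiv ℝ (fun z ↦ (β (ψ z)).comp (fderiv ℝ ψ z)) y = _ := h3.fderiv
  rw [dForm_apply, h4, dForm_apply]
  simp [hsymm]

end ExteriorDerivative

/-! ### One-forms and contact forms read in the preferred charts of a manifold. -/

section Charts

variable {F : Type*} [NormedAddCommGroup F] [NormedSpace ℝ F]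
  {E : Type*} [NormedAddCommGroup E] [NormedSpace ℝ E]
  {H : Type*} [TopologicalSpace H] {I : ModelWithCorners ℝ E H}
  {M : Type*} [TopologicalSpace M] [ChartedSpace H M]
  {E' : Type*} [NormedAddCommGroup E'] [NormedSpace ℝ E']
  {H' : Type*} [TopologicalSpace H'] {I' : ModelWithCorners ℝ E' H'}
  {M' : Type*} [TopologicalSpace M'] [ChartedSpace H' M']
  {E'' : Type*} [NormedAddCommGroup E''] [NormedSpace ℝ E'']
  {H'' : Type*} [TopologicalSpace H''] {I'' : ModelWithCorners ℝ E'' H''}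
  {M'' : Type*} [TopologicalSpace M''] [ChartedSpace H'' M'']

/-- The differential of a map of manifolds, as a map between the model spaces. -/
def tderiv (I : ModelWithCorners ℝ E H) (I' : ModelWithCorners ℝ E' H') (f : M → M') (x : M) :
    E →L[ℝ] E' := mfderiv I I' f x

/-- The value of a one-form, as a linear form on the model space. -/
def OneForm.val (η : OneForm I M) (x : M) : E →L[ℝ] ℝ := η x

/-- The value of the exterior derivative of a one-form, as a bilinear form on the model space. -/
def OneForm.dval (η : OneForm I M) (x : M) : E →L[ℝ] E →L[ℝ] ℝ := extDerivForm I η x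

theorem tderiv_comp {g : M' → M''} {f : M → M'} {x : M} (hg : MDifferentiableAt I' I'' g (f x))
    (hf : MDifferentiableAt I I' f x) :
    tderiv I I'' (g ∘ f) x = (tderiv I' I'' g (f x)).comp (tderiv I I' f x) :=
  mfderiv_comp x hg hf

theorem tderiv_congr {f g : M → M'} {x : M} (h : f =ᶠ[𝓝 x] g) :
    tderiv I I' f x = tderiv I I' g x :=
  h.mfderiv_eq

theorem tderiv_eq_fderiv (f : F → E) (x : F) : tderiv 𝓘(ℝ, F) 𝓘(ℝ, E) f x = fderiv ℝ f x :=
  mfderiv_eq_fderiv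

/-- The tangent space at x is identified with the model space through the preferred chart at x
itself. -/
theorem tderiv_extChartAt_self [IsManifold I ∞ M] (x : M) :
    tderiv I 𝓘(ℝ, E) (extChartAt I x) x = ContinuousLinearMap.id ℝ E :=
  mfderiv_extChartAt_self

theorem mdifferentiableAt_extChartAt' [IsManifold I ∞ M] {x₀ x : M}
    (hx : x ∈ (extChartAt I x₀).source) : MDifferentiableAt I 𝓘(ℝ, E) (extChartAt I x₀) x :=
  mdifferentiableAt_extChartAt (by simpa using hx)

variable [I.Boundaryless]

theorem formInChart_eq (η : OneForm I M) (x₀ : M) (y : E) :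
    formInChart I η x₀ y =
      (OneForm.val η ((extChartAt I x₀).symm y)).comp
        (tderiv 𝓘(ℝ, E) I (extChartAt I x₀).symm y) := by
  rw [formInChart, I.range_eq_univ, mfderivWithin_univ]
  rfl

theorem formInChart_extChartAt (η : OneForm I M) {x₀ x : M} (hx : x ∈ (extChartAt I x₀).source) :
    formInChart I η x₀ (extChartAt I x₀ x) =
      (OneForm.val η x).comp (tderiv 𝓘(ℝ, E) I (extChartAt I x₀).symm (extChartAt I x₀ x)) := by
  rw [formInChart_eq, (extChartAt I x₀).left_inv hx]

variable [IsManifold I ∞ M]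

theorem mdifferentiableAt_extChartAt_symm {x₀ : M} {y : E} (hy : y ∈ (extChartAt I x₀).target) :
    MDifferentiableAt 𝓘(ℝ, E) I (extChartAt I x₀).symm y := by
  have h := mdifferentiableWithinAt_extChartAt_symm (I := I) hy
  rwa [I.range_eq_univ, mdifferentiableWithinAt_univ] at h

theorem tderiv_symm_comp_tderiv {x₀ x : M} (hx : x ∈ (extChartAt I x₀).source) :
    (tderiv 𝓘(ℝ, E) I (extChartAt I x₀).symm (extChartAt I x₀ x)).comp
      (tderiv I 𝓘(ℝ, E) (extChartAt I x₀) x) = ContinuousLinearMap.id ℝ E := by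
  have h := mfderivWithin_extChartAt_symm_comp_mfderiv_extChartAt' (I := I) hx
  rw [I.range_eq_univ, mfderivWithin_univ] at h
  exact h

theorem tderiv_comp_tderiv_symm {x₀ x : M} (hx : x ∈ (extChartAt I x₀).source) :
    (tderiv I 𝓘(ℝ, E) (extChartAt I x₀) x).comp
      (tderiv 𝓘(ℝ, E) I (extChartAt I x₀).symm (extChartAt I x₀ x)) =
        ContinuousLinearMap.id ℝ E := by
  have h := mfderiv_extChartAt_comp_mfderivWithin_extChartAt_symm' (I := I) hx
  rw [I.range_eq_univ, mfderivWithin_univ] at h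
  exact h

theorem formInChart_comp_tderiv (η : OneForm I M) {x₀ x : M}
    (hx : x ∈ (extChartAt I x₀).source) :
    (formInChart I η x₀ (extChartAt I x₀ x)).comp (tderiv I 𝓘(ℝ, E) (extChartAt I x₀) x) =
      OneForm.val η x := by
  rw [formInChart_extChartAt η hx, ContinuousLinearMap.comp_assoc, tderiv_symm_comp_tderiv hx,
    ContinuousLinearMap.comp_id]

theorem formInChart_self (η : OneForm I M) (x : M) :
    formInChart I η x (extChartAt I x x) = OneForm.val η x := by
  have := formInChart_comp_tderiv η (mem_extChartAt_source (I := I) x)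
  rwa [tderiv_extChartAt_self, ContinuousLinearMap.comp_id] at this

/-- Bridge between smoothness as a section of the cotangent bundle and smoothness of the chart
expression. -/
theorem trivializationAt_oneForm_snd (η : OneForm I M) {x₀ x : M}
    (hx : x ∈ (extChartAt I x₀).source) :
    (trivializationAt (E →L[ℝ] ℝ) (fun x : M ↦ TangentSpace I x →L[ℝ] Bundle.Trivial M ℝ x) x₀
      ⟨x, η x⟩).2 = formInChart I η x₀ (extChartAt I x₀ x) := by
  rw [formInChart_extChartAt η hx]
  have h := TangentBundle.symmL_trivializationAt (𝕜 := ℝ) (I := I) (x₀ := x₀) (x := x)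
    (by simpa using hx)
  rw [I.range_eq_univ, mfderivWithin_univ] at h
  have h2 : (trivializationAt ℝ (Bundle.Trivial M ℝ) x₀).continuousLinearMapAt ℝ x =
      ContinuousLinearMap.id ℝ ℝ := by
    ext
    simp
  rw [hom_trivializationAt_apply]
  simp only [ContinuousLinearMap.inCoordinates]
  rw [h2, h]
  rfl

theorem contMDiffAt_extChartAt_symm {x₀ : M} {y : E} (hy : y ∈ (extChartAt I x₀).target) :
    ContMDiffAt 𝓘(ℝ, E) I ∞ (extChartAt I x₀).symm y :=
  (contMDiffOn_extChartAt_symm x₀).contMDiffAt ((isOpen_extChartAt_target x₀).mem_nhds hy)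

theorem IsSmoothForm.contDiffAt_formInChart {η : OneForm I M} (hη : IsSmoothForm I η) {x₀ : M}
    {y : E} (hy : y ∈ (extChartAt I x₀).target) : ContDiffAt ℝ ∞ (formInChart I η x₀) y := by
  have hx := (extChartAt I x₀).map_target hy
  have h1 := ((trivializationAt (E →L[ℝ] ℝ)
    (fun x : M ↦ TangentSpace I x →L[ℝ] Bundle.Trivial M ℝ x) x₀).contMDiffAt_section_iff
      (by simpa using hx)).1 (hη ((extChartAt I x₀).symm y))
  have h2 := (h1.comp y (contMDiffAt_extChartAt_symm hy)).contDiffAt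
  refine h2.congr_of_eventuallyEq ?_
  filter_upwards [(isOpen_extChartAt_target x₀).mem_nhds hy] with z hz
  rw [Function.comp_apply, trivializationAt_oneForm_snd η ((extChartAt I x₀).map_target hz),
    (extChartAt I x₀).right_inv hz]

theorem isSmoothForm_of_contDiffAt {η : OneForm I M}
    (h : ∀ x, ContDiffAt ℝ ∞ (formInChart I η x) (extChartAt I x x)) : IsSmoothForm I η := by
  intro x
  refine ((trivializationAt (E →L[ℝ] ℝ)
    (fun x : M ↦ TangentSpace I x →L[ℝ] Bundle.Trivial M ℝ x) x).contMDiffAt_section_iff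
      (by simp)).2 ?_
  refine ((h x).contMDiffAt.comp x contMDiffAt_extChartAt).congr_of_eventuallyEq ?_
  filter_upwards [(isOpen_extChartAt_source x).mem_nhds (mem_extChartAt_source (I := I) x)]
    with z hz
  exact trivializationAt_oneForm_snd η hz

theorem dval_eq_dForm (η : OneForm I M) (x : M) :
    OneForm.dval η x = dForm (formInChart I η x) (extChartAt I x x) := by
  have h := tderiv_extChartAt_self (I := I) x
  rw [tderiv] at h
  ext u v
  simp only [OneForm.dval, extDerivForm, extDerivInChart, I.range_eq_univ, fderivWithin_univ]
  rw [h]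
  rfl

/-- The exterior derivative of the pullback of a one-form by a smooth map from a vector space. -/
theorem dForm_pullback_eq_dval {η : OneForm I M} (hη : IsSmoothForm I η) {g : F → M} {y : F}
    (hg : ContMDiffAt 𝓘(ℝ, F) I ∞ g y) (u v : F) :
    dForm (fun z ↦ (OneForm.val η (g z)).comp (tderiv 𝓘(ℝ, F) I g z)) y u v =
      OneForm.dval η (g y) (tderiv 𝓘(ℝ, F) I g y u) (tderiv 𝓘(ℝ, F) I g y v) := by
  set φ := extChartAt I (g y) with hφ
  have hev : ∀ᶠ z in 𝓝 y, g z ∈ φ.source ∧ MDifferentiableAt 𝓘(ℝ, F) I g z := by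
    have h1 : ∀ᶠ z in 𝓝 y, g z ∈ φ.source :=
      hg.continuousAt.preimage_mem_nhds (extChartAt_source_mem_nhds (g y))
    have hg1 : ContMDiffAt 𝓘(ℝ, F) I 1 g y := hg.of_le (by exact_mod_cast le_top)
    have h2 : ∀ᶠ z in 𝓝 y, ContMDiffAt 𝓘(ℝ, F) I 1 g z := 
      (contMDiffAt_iff_contMDiffAt_nhds (by simp)).1 hg1
    filter_upwards [h1, h2] with z hz hz'
    exact ⟨hz, hz'.mdifferentiableAt (by simp)⟩
  have hder : ∀ z, g z ∈ φ.source → MDifferentiableAt 𝓘(ℝ, F) I g z →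
      fderiv ℝ (φ ∘ g) z = (tderiv I 𝓘(ℝ, E) φ (g z)).comp (tderiv 𝓘(ℝ, F) I g z) := by
    intro z hz hgz
    rw [← tderiv_eq_fderiv, tderiv_comp (mdifferentiableAt_extChartAt' hz) hgz]
  have hψ : ContDiffAt ℝ ∞ (φ ∘ g) y :=
    ((contMDiffAt_extChartAt (I := I) (n := ∞) (x := g y)).comp y hg).contDiffAt
  have hβ : DifferentiableAt ℝ (formInChart I η (g y)) ((φ ∘ g) y) :=
    (hη.contDiffAt_formInChart (mem_extChartAt_target (g y))).differentiableAt (by simp)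
  -- Near y, the pullback by g is the pullback of the chart expression by φ ∘ g, to which the vector
  -- space case applies.
  have heq : (fun z ↦ (OneForm.val η (g z)).comp (tderiv 𝓘(ℝ, F) I g z)) =ᶠ[𝓝 y]
      fun z ↦ (formInChart I η (g y) ((φ ∘ g) z)).comp (fderiv ℝ (φ ∘ g) z) := by
    filter_upwards [hev] with z hz
    rw [hder z hz.1 hz.2, ← ContinuousLinearMap.comp_assoc, Function.comp_apply,
      formInChart_comp_tderiv η hz.1]
  have h0 := hev.self_of_nhds
  rw [dForm_congr heq, dForm_pullback hψ hβ, dval_eq_dForm, hder y h0.1 h0.2,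
    tderiv_extChartAt_self, ContinuousLinearMap.id_comp]
  rfl

/-- The exterior derivative is defined with a chart that changes with the point. This is its
independence of the chart, which allows a single chart to be used on an open set; it is naturality
under the inverse chart. -/
theorem IsSmoothForm.dForm_formInChart {η : OneForm I M} (hη : IsSmoothForm I η) {x₀ : M}
    {y : E} (hy : y ∈ (extChartAt I x₀).target) (u v : E) :
    dForm (formInChart I η x₀) y u v = OneForm.dval η ((extChartAt I x₀).symm y)
      (tderiv 𝓘(ℝ, E) I (extChartAt I x₀).symm y u)
      (tderiv 𝓘(ℝ, E) I (extChartAt I x₀).symm y v) := by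
  rw [← dForm_pullback_eq_dval hη (contMDiffAt_extChartAt_symm hy)]
  congr 3
  funext z
  exact formInChart_eq η x₀ z

theorem dval_antisymm (η : OneForm I M) (x : M) (u v : E) :
    OneForm.dval η x u v = -OneForm.dval η x v u := by
  rw [dval_eq_dForm, dForm_antisymm]

variable [FiniteDimensional ℝ E]

/-- The tangent spaces of a contact manifold are linear contact spaces. -/
theorem IsContactForm.isLinContact {η : OneForm I M} (hη : IsContactForm I η) (x : M) :
    IsLinContact (OneForm.val η x) (OneForm.dval η x) := by
  obtain ⟨-, n, hn, hv⟩ := hη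
  obtain ⟨v, hv⟩ := hv x
  let a : E →ₗ[ℝ] ℝ := (OneForm.val η x).toLinearMap
  let b : E →ₗ[ℝ] E →ₗ[ℝ] ℝ := (ContinuousLinearMap.coeLM ℝ).comp (OneForm.dval η x).toLinearMap
  have hb : ∀ u w, b u w = -b w u := dval_antisymm η x
  have h : Nondeg a b := nondeg_of_wedgePow_ne_zero hb hn (v := v) hv
  exact ⟨hb, h, h.exists_reeb hb hn⟩

/-- A smooth form that makes the tangent spaces linear contact spaces is a contact form. -/
theorem isContactForm_of_isLinContact {η : OneForm I M} (hη : IsSmoothForm I η) {n : ℕ}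
    (hn : Module.finrank ℝ E = 2 * n + 1)
    (h : ∀ x, IsLinContact (OneForm.val η x) (OneForm.dval η x)) : IsContactForm I η := by
  refine ⟨hη, n, hn, fun x ↦ ?_⟩
  let a : E →ₗ[ℝ] ℝ := (OneForm.val η x).toLinearMap
  let b : E →ₗ[ℝ] E →ₗ[ℝ] ℝ := (ContinuousLinearMap.coeLM ℝ).comp (OneForm.dval η x).toLinearMap
  have hb : ∀ u w, b u w = -b w u := dval_antisymm η x
  have hnd : Nondeg a b := (h x).nondeg
  exact hnd.exists_wedgePow_ne_zero hb hn

/-- The differentials of the chart and of its inverse are mutually inverse and carry both forms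
across, so the kernels and the Reeb vector are transported. -/
theorem IsContactForm.isLinContact_formInChart {η : OneForm I M} (hη : IsContactForm I η)
    {x₀ : M} {y : E} (hy : y ∈ (extChartAt I x₀).target) :
    IsLinContact (formInChart I η x₀ y) (dForm (formInChart I η x₀) y) := by
  set x := (extChartAt I x₀).symm y with hx
  have hxs : x ∈ (extChartAt I x₀).source := (extChartAt I x₀).map_target hy
  have hxy : extChartAt I x₀ x = y := (extChartAt I x₀).right_inv hy
  have h := hη.isLinContact x
  have h1 := tderiv_symm_comp_tderiv hxs
  have h2 := tderiv_comp_tderiv_symm hxs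
  rw [hxy] at h1 h2
  set P := tderiv 𝓘(ℝ, E) I (extChartAt I x₀).symm y with hP
  set Q := tderiv I 𝓘(ℝ, E) (extChartAt I x₀) x with hQ
  have hPQ : ∀ u, P (Q u) = u := fun u ↦ congrArg (fun f : E →L[ℝ] E ↦ f u) h1
  have hQP : ∀ u, Q (P u) = u := fun u ↦ congrArg (fun f : E →L[ℝ] E ↦ f u) h2
  have hα : ∀ u, formInChart I η x₀ y u = OneForm.val η x (P u) := fun u ↦ by
    rw [formInChart_eq]
    rfl
  have hd : ∀ u v, dForm (formInChart I η x₀) y u v = OneForm.dval η x (P u) (P v) :=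
    hη.1.dForm_formInChart hy
  refine ⟨dForm_antisymm _ _, fun v hv hv' ↦ ?_, ?_⟩
  · have : P v = 0 := by
      refine h.nondeg _ (by rw [← hα, hv]) fun w ↦ ?_
      have := hv' (Q w)
      rwa [hd, hPQ] at this
    rw [← hQP v, this, map_zero]
  · obtain ⟨R, hR1, hR2⟩ := h.exists_reeb
    exact ⟨Q R, by rw [hα, hPQ, hR1], fun w ↦ by rw [hd, hPQ, hR2]⟩

end Charts

/-! ### The preferred charts of TM × ℝ in terms of those of M. -/

section TangentCharts

variable {E : Type*} [NormedAddCommGroup E] [NormedSpace ℝ E]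
  {H : Type*} [TopologicalSpace H] {I : ModelWithCorners ℝ E H} 
  {M : Type*} [TopologicalSpace M] [ChartedSpace H M] [IsManifold I ∞ M]

theorem trivializationAt_tangent_snd {x₀ x : M} (hx : x ∈ (extChartAt I x₀).source)
    (w : TangentSpace I x) :
    (trivializationAt E (TangentSpace I : M → Type _) x₀ ⟨x, w⟩).2 =
      tderiv I 𝓘(ℝ, E) (extChartAt I x₀) x w := by
  have hx' : x ∈ (chartAt H x₀).source := by simpa using hx
  have h := TangentBundle.continuousLinearMapAt_trivializationAt (𝕜 := ℝ) (I := I) hx'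
  have h2 : Trivialization.linearMapAt ℝ (trivializationAt E (TangentSpace I : M → Type _) x₀) x w =
      (trivializationAt E (TangentSpace I : M → Type _) x₀ ⟨x, w⟩).2 := by
    rw [Trivialization.coe_linearMapAt_of_mem _ (by simpa using hx)]
  exact h2.symm.trans (congrArg (fun f : E →L[ℝ] E ↦ f w) h)

theorem extChartAt_tangent_source (v : TangentBundle I M) :
    (extChartAt I.tangent v).source = {q | q.proj ∈ (extChartAt I v.proj).source} := by
  ext q
  simp [TangentBundle.mem_chart_source_iff]

theorem extChartAt_tangent_apply (v : TangentBundle I M) {q : TangentBundle I M}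
    (hq : q.proj ∈ (extChartAt I v.proj).source) :
    extChartAt I.tangent v q = (extChartAt I v.proj q.proj,
      tderiv I 𝓘(ℝ, E) (extChartAt I v.proj) q.proj q.snd) := by
  rw [← trivializationAt_tangent_snd hq]
  rw [show I.tangent = I.prod 𝓘(ℝ, E) from rfl, FiberBundle.extChartAt]
  simp

theorem extChartAt_extended_source (p : TangentBundle I M × ℝ) :
    (extChartAt (I.tangent.prod 𝓘(ℝ, ℝ)) p).source =
      {q | q.1.proj ∈ (extChartAt I p.1.proj).source} := by
  rw [extChartAt_prod, PartialEquiv.prod_source, extChartAt_tangent_source]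
  ext q
  refine and_iff_left ?_
  rw [extChartAt_source, chartAt_self_eq]
  exact mem_univ _

theorem extChartAt_extended_apply (p : TangentBundle I M × ℝ) {q : TangentBundle I M × ℝ}
    (hq : q.1.proj ∈ (extChartAt I p.1.proj).source) :
    extChartAt (I.tangent.prod 𝓘(ℝ, ℝ)) p q = ((extChartAt I p.1.proj q.1.proj,
      tderiv I 𝓘(ℝ, E) (extChartAt I p.1.proj) q.1.proj q.1.snd), q.2) := by
  rw [extChartAt_prod]
  exact Prod.ext (extChartAt_tangent_apply _ hq) rfl

variable [I.Boundaryless]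

/-- The explicit candidate for the inverse chart is checked to be a right inverse; the target and
the inverse of the chart are then deduced from it. -/
theorem extChartAt_extended_symm_aux (p : TangentBundle I M × ℝ) {y : (E × E) × ℝ}
    (hy : y.1.1 ∈ (extChartAt I p.1.proj).target) :
    extChartAt (I.tangent.prod 𝓘(ℝ, ℝ)) p ((⟨(extChartAt I p.1.proj).symm y.1.1,
      tderiv 𝓘(ℝ, E) I (extChartAt I p.1.proj).symm y.1.1 y.1.2⟩ : TangentBundle I M), y.2) =
        y := by
  have hs := (extChartAt I p.1.proj).map_target hy
  rw [extChartAt_extended_apply p hs]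
  have h := tderiv_comp_tderiv_symm hs
  rw [(extChartAt I p.1.proj).right_inv hy] at h
  have h' := congrArg (fun f : E →L[ℝ] E ↦ f y.1.2) h
  refine Prod.ext (Prod.ext ((extChartAt I p.1.proj).right_inv hy) ?_) rfl
  exact h'

theorem extChartAt_extended_target (p : TangentBundle I M × ℝ) :
    (extChartAt (I.tangent.prod 𝓘(ℝ, ℝ)) p).target =
      {y | y.1.1 ∈ (extChartAt I p.1.proj).target} := by
  ext y
  constructor
  · intro hy
    have hs := (extChartAt (I.tangent.prod 𝓘(ℝ, ℝ)) p).map_target hy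
    rw [extChartAt_extended_source] at hs
    have := extChartAt_extended_apply p hs
    rw [(extChartAt (I.tangent.prod 𝓘(ℝ, ℝ)) p).right_inv hy] at this
    rw [this]
    exact (extChartAt I p.1.proj).map_source hs
  · intro hy
    rw [← extChartAt_extended_symm_aux p hy]
    refine (extChartAt (I.tangent.prod 𝓘(ℝ, ℝ)) p).map_source ?_
    rw [extChartAt_extended_source]
    exact (extChartAt I p.1.proj).map_target hy

theorem extChartAt_extended_symm_apply (p : TangentBundle I M × ℝ) {y : (E × E) × ℝ}
    (hy : y.1.1 ∈ (extChartAt I p.1.proj).target) :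
    (extChartAt (I.tangent.prod 𝓘(ℝ, ℝ)) p).symm y =
      ((⟨(extChartAt I p.1.proj).symm y.1.1,
        tderiv 𝓘(ℝ, E) I (extChartAt I p.1.proj).symm y.1.1 y.1.2⟩ : TangentBundle I M), y.2) := by
  conv_lhs => rw [← extChartAt_extended_symm_aux p hy]
  refine (extChartAt (I.tangent.prod 𝓘(ℝ, ℝ)) p).left_inv ?_
  rw [extChartAt_extended_source]
  exact (extChartAt I p.1.proj).map_target hy

end TangentCharts

/-! ### The extended form on the model space -/

section ModelForm

variable {E : Type*} [NormedAddCommGroup E] [NormedSpace ℝ E]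

/-- The form `α^c + t α^v` on `(E × E) × ℝ`, for a one-form `α` on the vector space `E`. -/
def extForm (α : E → E →L[ℝ] ℝ) (y : (E × E) × ℝ) : (E × E) × ℝ →L[ℝ] ℝ :=
  (fderiv ℝ α y.1.1 y.1.2 + y.2 • α y.1.1).comp
      ((ContinuousLinearMap.fst ℝ E E).comp (ContinuousLinearMap.fst ℝ (E × E) ℝ)) +
    (α y.1.1).comp ((ContinuousLinearMap.snd ℝ E E).comp (ContinuousLinearMap.fst ℝ (E × E) ℝ))

theorem extForm_apply (α : E → E →L[ℝ] ℝ) (y u : (E × E) × ℝ) :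
    extForm α y u = fderiv ℝ α y.1.1 y.1.2 u.1.1 + y.2 * α y.1.1 u.1.1 + α y.1.1 u.1.2 := by
  simp [extForm]

set_option synthInstance.maxHeartbeats 200000 in
theorem contDiffAt_extForm {α : E → E →L[ℝ] ℝ} {y : (E × E) × ℝ} (hα : ContDiffAt ℝ ∞ α y.1.1) :
    ContDiffAt ℝ ∞ (extForm α) y := by
  have h1 : ContDiffAt ℝ ∞ (fun z : (E × E) × ℝ ↦ z.1.1) y := by fun_prop
  have h2 : ContDiffAt ℝ ∞ (fun z : (E × E) × ℝ ↦ α z.1.1) y := hα.comp y h1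
  have h3 : ContDiffAt ℝ ∞ (fun z : (E × E) × ℝ ↦ fderiv ℝ α z.1.1) y :=
    (hα.fderiv_right (m := ∞) (by simp)).comp y h1
  have h4 : ContDiffAt ℝ ∞ (fun z : (E × E) × ℝ ↦ z.1.2) y := by fun_prop
  have h5 : ContDiffAt ℝ ∞ (fun z : (E × E) × ℝ ↦ z.2) y := by fun_prop
  exact (((h3.clm_apply h4).add (h5.smul h2)).clm_comp contDiffAt_const).add
    (h2.clm_comp contDiffAt_const)

set_option synthInstance.maxHeartbeats 200000 in
theorem fderiv_extForm {α : E → E →L[ℝ] ℝ} {y : (E × E) × ℝ} (hα : ContDiffAt ℝ ∞ α y.1.1)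
    (u v : (E × E) × ℝ) :
    fderiv ℝ (extForm α) y u v = fderiv ℝ (fderiv ℝ α) y.1.1 u.1.1 y.1.2 v.1.1 +
      fderiv ℝ α y.1.1 u.1.2 v.1.1 + u.2 * α y.1.1 v.1.1 + y.2 * fderiv ℝ α y.1.1 u.1.1 v.1.1 +
      fderiv ℝ α y.1.1 u.1.1 v.1.2 := by
  have h1 : HasFDerivAt (fun z : (E × E) × ℝ ↦ z.1.1)
      ((ContinuousLinearMap.fst ℝ E E).comp (ContinuousLinearMap.fst ℝ (E × E) ℝ)) y :=
    ((ContinuousLinearMap.fst ℝ E E).comp (ContinuousLinearMap.fst ℝ (E × E) ℝ)).hasFDerivAt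
  have h4 : HasFDerivAt (fun z : (E × E) × ℝ ↦ z.1.2)
      ((ContinuousLinearMap.snd ℝ E E).comp (ContinuousLinearMap.fst ℝ (E × E) ℝ)) y :=
    ((ContinuousLinearMap.snd ℝ E E).comp (ContinuousLinearMap.fst ℝ (E × E) ℝ)).hasFDerivAt
  have h5 : HasFDerivAt (fun z : (E × E) × ℝ ↦ z.2) (ContinuousLinearMap.snd ℝ (E × E) ℝ) y :=
    (ContinuousLinearMap.snd ℝ (E × E) ℝ).hasFDerivAt
  have h2 : HasFDerivAt (fun z : (E × E) × ℝ ↦ α z.1.1) _ y :=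
    (hα.differentiableAt (by simp)).hasFDerivAt.comp y h1
  have hα' : ContDiffAt ℝ ∞ (fderiv ℝ α) y.1.1 := hα.fderiv_right (by simp)
  have h30 : HasFDerivAt (fderiv ℝ α) (fderiv ℝ (fderiv ℝ α) y.1.1) y.1.1 :=
    (hα'.differentiableAt (by simp)).hasFDerivAt
  have h3 : HasFDerivAt (fun z : (E × E) × ℝ ↦ fderiv ℝ α z.1.1)
      ((fderiv ℝ (fderiv ℝ α) y.1.1).comp
        ((ContinuousLinearMap.fst ℝ E E).comp (ContinuousLinearMap.fst ℝ (E × E) ℝ))) y :=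
    HasFDerivAt.comp (g := fderiv ℝ α) y h30 h1
  have h6 := ((h3.clm_apply h4).clm_apply (hasFDerivAt_const v.1.1 y)).add
    ((h5.mul (h2.clm_apply (hasFDerivAt_const v.1.1 y)))) |>.add
    (h2.clm_apply (hasFDerivAt_const v.1.2 y))
  -- The derivative is identified by computing that of the scalar function obtained by fixing v in
  -- two ways.
  have h7 : HasFDerivAt (fun z ↦ extForm α z v) _ y :=
    (((contDiffAt_extForm hα).differentiableAt (by simp)).hasFDerivAt).clm_apply
      (hasFDerivAt_const v y)
  simp only [extForm_apply] at h7
  have h8 := congrArg (fun f : (E × E) × ℝ →L[ℝ] ℝ ↦ f u) (h7.unique h6)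
  simp only [add_apply, ContinuousLinearMap.comp_apply,
    ContinuousLinearMap.flip_apply, zero_apply, smul_apply,
    map_zero, zero_add, smul_eq_mul, ContinuousLinearMap.coe_fst', ContinuousLinearMap.coe_snd']
    at h8
  rw [h8]
  ring

set_option synthInstance.maxHeartbeats 200000 in
-- The second derivatives of α involve only the base components a, a', so they disappear as soon as
-- one of these is zero. What remains pairs base with fibre directions by dα, and the ℝ direction
-- with the base by α.
theorem dForm_extForm {α : E → E →L[ℝ] ℝ} {y : (E × E) × ℝ} (hα : ContDiffAt ℝ ∞ α y.1.1)
    (a b a' b' : E) (s s' : ℝ) :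
    dForm (extForm α) y ((a, b), s) ((a', b'), s') =
      (fderiv ℝ (fderiv ℝ α) y.1.1 a y.1.2 a' - fderiv ℝ (fderiv ℝ α) y.1.1 a' y.1.2 a) +
      dForm α y.1.1 b a' + dForm α y.1.1 a b' + s * α y.1.1 a' - s' * α y.1.1 a +
      y.2 * dForm α y.1.1 a a' := by
  rw [dForm_apply, fderiv_extForm hα, fderiv_extForm hα, dForm_apply, dForm_apply, dForm_apply]
  ring

set_option synthInstance.maxHeartbeats 200000 in
-- Let ((a, b), s) be in both kernels. Testing against the ℝ direction gives α(a) = 0 and against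
-- the fibre dα(a, ·) = 0, so a = 0. Testing against the base then gives dα(b, ·) + s α = 0; at R
-- this yields s = 0, and α(b) = 0 comes from the first kernel, so b = 0. The Reeb vector is the
-- vertical lift of R.
theorem isLinContact_extForm {α : E → E →L[ℝ] ℝ} {y : (E × E) × ℝ}
    (hα : ContDiffAt ℝ ∞ α y.1.1) (h : IsLinContact (α y.1.1) (dForm α y.1.1)) :
    IsLinContact (extForm α y) (dForm (extForm α) y) := by
  have hd := dForm_extForm hα
  have h0 : ∀ w : E, fderiv ℝ (fderiv ℝ α) y.1.1 0 y.1.2 w -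
      fderiv ℝ (fderiv ℝ α) y.1.1 w y.1.2 0 = 0 := fun w ↦ by
    rw [map_zero, map_zero, zero_apply, zero_apply,
      sub_zero]
  have h0' : ∀ w : E, fderiv ℝ (fderiv ℝ α) y.1.1 w y.1.2 0 -
      fderiv ℝ (fderiv ℝ α) y.1.1 0 y.1.2 w = 0 := fun w ↦ by rw [← neg_sub, h0, neg_zero]
  generalize fderiv ℝ (fderiv ℝ α) y.1.1 = D at hd h0 h0'
  obtain ⟨R, hR1, hR2⟩ := h.exists_reeb
  refine ⟨dForm_antisymm _ _, ?_, ((0, R), 0), by simp [extForm_apply, hR1], ?_⟩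
  · rintro ⟨⟨a, b⟩, s⟩ hu hu'
    rw [extForm_apply] at hu
    have h1 : α y.1.1 a = 0 := by
      have := hu' ((0, 0), 1)
      rw [hd, h0'] at this
      simpa using this
    have h2 : a = 0 := h.nondeg a h1 fun w ↦ by
      have := hu' ((0, w), 0)
      rw [hd, h0'] at this
      simpa using this
    subst h2
    have h3 : α y.1.1 b = 0 := by simpa using hu
    have h4 : ∀ w, dForm α y.1.1 b w + s * α y.1.1 w = 0 := fun w ↦ by
      have := hu' ((w, 0), 0)
      rw [hd, h0] at this
      simpa using this
    have h5 : s = 0 := by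
      have := h4 R
      rwa [h.right_reeb hR2, hR1, zero_add, mul_one] at this
    have h6 : b = 0 := h.nondeg b h3 fun w ↦ by simpa [h5] using h4 w
    rw [h5, h6]
    rfl
  · rintro ⟨⟨a, b⟩, s⟩
    rw [hd, h0]
    simp [hR2]

end ModelForm

/-! ### The extended form in charts -/

section ExtendedForm

variable {E : Type*} [NormedAddCommGroup E] [NormedSpace ℝ E]
  {H : Type*} [TopologicalSpace H] {I : ModelWithCorners ℝ E H}
  {M : Type*} [TopologicalSpace M] [ChartedSpace H M] [IsManifold I ∞ M]

theorem mdifferentiableAt_fst_extended (p : TangentBundle I M × ℝ) :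
    MDifferentiableAt (I.tangent.prod 𝓘(ℝ, ℝ)) I.tangent
      (Prod.fst : TangentBundle I M × ℝ → TangentBundle I M) p :=
  mdifferentiableAt_fst

theorem mdifferentiableAt_tangent_proj (v : TangentBundle I M) :
    MDifferentiableAt I.tangent I (fun w : TangentBundle I M ↦ w.proj) v :=
  (contMDiffAt_proj (n := 1) (TangentSpace I : M → Type _)).mdifferentiableAt (by simp)

/-- The intermediate vectors enter through equations, so that any known expression for the projected
vectors can be substituted. -/
theorem val_extendedForm_apply (η : OneForm I M) (p : TangentBundle I M × ℝ) (u : (E × E) × ℝ)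
    {ξ : E × E} (hξ : ξ = tderiv (I.tangent.prod 𝓘(ℝ, ℝ)) I.tangent
      (Prod.fst : TangentBundle I M × ℝ → TangentBundle I M) p u)
    {a : E} (ha : a = tderiv I.tangent I (fun w : TangentBundle I M ↦ w.proj) p.1 ξ) :
    OneForm.val (I := I.tangent.prod 𝓘(ℝ, ℝ)) (extendedForm I η) p u =
      tderiv I.tangent 𝓘(ℝ, ℝ) (fun w : TangentBundle I M ↦ η w.proj w.snd) p.1 ξ +
        OneForm.dval η p.1.proj p.1.snd a + p.2 * OneForm.val η p.1.proj a := by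
  subst ha hξ
  rfl

variable [I.Boundaryless]

/-- The function `v ↦ η(v)` on the tangent bundle is differentiable. -/
theorem IsSmoothForm.mdifferentiableAt_eval {η : OneForm I M} (hη : IsSmoothForm I η)
    (v : TangentBundle I M) :
    MDifferentiableAt I.tangent 𝓘(ℝ, ℝ) (fun w : TangentBundle I M ↦ η w.proj w.snd) v := by
  have hv : v.proj ∈ (extChartAt I v.proj).source := mem_extChartAt_source _
  have h1 : MDifferentiableAt I.tangent 𝓘(ℝ, E × E) (extChartAt I.tangent v) v :=
    mdifferentiableAt_extChartAt' (mem_extChartAt_source v)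
  have hα : DifferentiableAt ℝ (formInChart I η v.proj) (extChartAt I.tangent v v).1 := by
    rw [extChartAt_tangent_apply v hv]
    exact (hη.contDiffAt_formInChart (mem_extChartAt_target v.proj)).differentiableAt (by simp)
  have h2 : DifferentiableAt ℝ (fun z : E × E ↦ formInChart I η v.proj z.1 z.2)
      (extChartAt I.tangent v v) :=
    (hα.comp (extChartAt I.tangent v v) differentiableAt_fst).clm_apply differentiableAt_snd
  refine (h2.mdifferentiableAt.comp v h1).congr_of_eventuallyEq ?_
  filter_upwards [extChartAt_source_mem_nhds (I := I.tangent) v] with w hw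
  rw [extChartAt_tangent_source] at hw
  rw [Function.comp_apply, extChartAt_tangent_apply v hw]
  exact (congrArg (fun f : E →L[ℝ] ℝ ↦ f w.snd) (formInChart_comp_tderiv η hw)).symm

/-- In the chart, d of the function v ↦ η(v) is ẋᵏ (∂_i η_k) dxⁱ + η_i dẋⁱ. Adding dη(ẋ, ·) replaces
∂_i η_k by ∂_k η_i, which gives the coordinate formula of the complete lift. -/
theorem IsSmoothForm.formInChart_extendedForm {η : OneForm I M} (hη : IsSmoothForm I η)
    (p : TangentBundle I M × ℝ) {y : (E × E) × ℝ} (hy : y.1.1 ∈ (extChartAt I p.1.proj).target) :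
    formInChart (I.tangent.prod 𝓘(ℝ, ℝ)) (extendedForm I η) p y =
      extForm (formInChart I η p.1.proj) y := by
  set φ := extChartAt I p.1.proj with hφ
  set α := formInChart I η p.1.proj with hα
  set Φ := extChartAt (I.tangent.prod 𝓘(ℝ, ℝ)) p with hΦ
  have hyΦ : y ∈ Φ.target := by rwa [hΦ, extChartAt_extended_target]
  have hev : ∀ᶠ z in 𝓝 y, z.1.1 ∈ φ.target :=
    (continuous_fst.comp continuous_fst).continuousAt.preimage_mem_nhds
      ((isOpen_extChartAt_target p.1.proj).mem_nhds hy)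
  have hsymm : ∀ z : (E × E) × ℝ, z.1.1 ∈ φ.target →
      Φ.symm z = ((⟨φ.symm z.1.1, tderiv 𝓘(ℝ, E) I φ.symm z.1.1 z.1.2⟩ : TangentBundle I M), z.2) :=
    fun z hz ↦ extChartAt_extended_symm_apply p hz
  have hdΦ : MDifferentiableAt 𝓘(ℝ, (E × E) × ℝ) (I.tangent.prod 𝓘(ℝ, ℝ)) Φ.symm y :=
    mdifferentiableAt_extChartAt_symm hyΦ
  let g : (E × E) × ℝ → TangentBundle I M := Prod.fst ∘ Φ.symm
  have hdg : MDifferentiableAt 𝓘(ℝ, (E × E) × ℝ) I.tangent g y :=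
    (mdifferentiableAt_fst_extended (Φ.symm y)).comp y hdΦ
  have hg : tderiv 𝓘(ℝ, (E × E) × ℝ) I.tangent g y =
      (tderiv (I.tangent.prod 𝓘(ℝ, ℝ)) I.tangent Prod.fst (Φ.symm y)).comp
        (tderiv 𝓘(ℝ, (E × E) × ℝ) (I.tangent.prod 𝓘(ℝ, ℝ)) Φ.symm y) :=
    tderiv_comp (mdifferentiableAt_fst_extended _) hdΦ
  have hαd : DifferentiableAt ℝ α y.1.1 :=
    (hη.contDiffAt_formInChart hy).differentiableAt (by simp)
  have heval : (tderiv I.tangent 𝓘(ℝ, ℝ) (fun w : TangentBundle I M ↦ η w.proj w.snd) (g y)).comp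
      (tderiv 𝓘(ℝ, (E × E) × ℝ) I.tangent g y) =
      fderiv ℝ (fun z : (E × E) × ℝ ↦ α z.1.1 z.1.2) y := by
    rw [← tderiv_comp (hη.mdifferentiableAt_eval _) hdg, ← tderiv_eq_fderiv]
    refine tderiv_congr ?_
    filter_upwards [hev] with z hz
    have : g z = ⟨φ.symm z.1.1, tderiv 𝓘(ℝ, E) I φ.symm z.1.1 z.1.2⟩ :=
      congrArg Prod.fst (hsymm z hz)
    rw [Function.comp_apply, this, hα, formInChart_eq]
    rfl
  have hproj : (tderiv I.tangent I (fun w : TangentBundle I M ↦ w.proj) (g y)).comp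
      (tderiv 𝓘(ℝ, (E × E) × ℝ) I.tangent g y) = (tderiv 𝓘(ℝ, E) I φ.symm y.1.1).comp
        ((ContinuousLinearMap.fst ℝ E E).comp (ContinuousLinearMap.fst ℝ (E × E) ℝ)) := by
    have h1 : HasFDerivAt (fun z : (E × E) × ℝ ↦ z.1.1)
        ((ContinuousLinearMap.fst ℝ E E).comp (ContinuousLinearMap.fst ℝ (E × E) ℝ)) y :=
      ((ContinuousLinearMap.fst ℝ E E).comp (ContinuousLinearMap.fst ℝ (E × E) ℝ)).hasFDerivAt
    rw [← tderiv_comp (mdifferentiableAt_tangent_proj _) hdg, ← h1.fderiv, ← tderiv_eq_fderiv,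
      ← tderiv_comp (f := fun z : (E × E) × ℝ ↦ z.1.1) (mdifferentiableAt_extChartAt_symm hy)
        h1.differentiableAt.mdifferentiableAt]
    refine tderiv_congr ?_
    filter_upwards [hev] with z hz
    exact congrArg (fun q : TangentBundle I M × ℝ ↦ q.1.proj) (hsymm z hz)
  refine ContinuousLinearMap.ext fun u ↦ ?_
  rw [formInChart_eq, ContinuousLinearMap.comp_apply,
    val_extendedForm_apply η (Φ.symm y) _ (ξ := tderiv 𝓘(ℝ, (E × E) × ℝ) I.tangent g y u)
      (by rw [hg]; rfl) (a := tderiv 𝓘(ℝ, E) I φ.symm y.1.1 u.1.1)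
      (congrArg (fun f : (E × E) × ℝ →L[ℝ] E ↦ f u) hproj).symm]
  have e1 : tderiv I.tangent 𝓘(ℝ, ℝ) (fun w : TangentBundle I M ↦ η w.proj w.snd) (Φ.symm y).1
      (tderiv 𝓘(ℝ, (E × E) × ℝ) I.tangent g y u) =
      fderiv ℝ (fun z : (E × E) × ℝ ↦ α z.1.1 z.1.2) y u :=
    congrArg (fun f : (E × E) × ℝ →L[ℝ] ℝ ↦ f u) heval
  have e2 : fderiv ℝ (fun z : (E × E) × ℝ ↦ α z.1.1 z.1.2) y u =
      fderiv ℝ α y.1.1 u.1.1 y.1.2 + α y.1.1 u.1.2 := by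
    have h1 : HasFDerivAt (fun z : (E × E) × ℝ ↦ z.1.1)
        ((ContinuousLinearMap.fst ℝ E E).comp (ContinuousLinearMap.fst ℝ (E × E) ℝ)) y :=
      ((ContinuousLinearMap.fst ℝ E E).comp (ContinuousLinearMap.fst ℝ (E × E) ℝ)).hasFDerivAt
    have h4 : HasFDerivAt (fun z : (E × E) × ℝ ↦ z.1.2)
        ((ContinuousLinearMap.snd ℝ E E).comp (ContinuousLinearMap.fst ℝ (E × E) ℝ)) y :=
      ((ContinuousLinearMap.snd ℝ E E).comp (ContinuousLinearMap.fst ℝ (E × E) ℝ)).hasFDerivAt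
    have h2 : HasFDerivAt (fun z : (E × E) × ℝ ↦ α z.1.1) _ y :=
      HasFDerivAt.comp (g := α) y hαd.hasFDerivAt h1
    rw [(h2.clm_apply h4).fderiv]
    simp [add_comm]
  rw [e1, e2, extForm_apply, hsymm y hy]
  have e3 := hη.dForm_formInChart hy y.1.2 u.1.1
  rw [dForm_apply] at e3
  have e4 : α y.1.1 u.1.1 = OneForm.val η (φ.symm y.1.1) (tderiv 𝓘(ℝ, E) I φ.symm y.1.1 u.1.1) := by
    rw [hα, formInChart_eq]
    rfl
  rw [e4]
  -- The exchange of the two slots of the derivative of α, paid for by dη.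
  have e5 : fderiv ℝ α y.1.1 y.1.2 u.1.1 = fderiv ℝ α y.1.1 u.1.1 y.1.2 +
    OneForm.dval η (φ.symm y.1.1) (tderiv 𝓘(ℝ, E) I φ.symm y.1.1 y.1.2)
      (tderiv 𝓘(ℝ, E) I φ.symm y.1.1 u.1.1) := by linarith
  rw [e5]
  ring

/-- `(TM × ℝ, η^c + t η^v)` is a contact manifold. -/
theorem isContactForm_extendedForm [FiniteDimensional ℝ E] {η : OneForm I M}
    (hη : IsContactForm I η) :
    IsContactForm (I.tangent.prod 𝓘(ℝ, ℝ)) (extendedForm I η) := by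
  have hloc : ∀ p : TangentBundle I M × ℝ,
      (extChartAt (I.tangent.prod 𝓘(ℝ, ℝ)) p p).1.1 ∈ (extChartAt I p.1.proj).target ∧
      formInChart (I.tangent.prod 𝓘(ℝ, ℝ)) (extendedForm I η) p
        =ᶠ[𝓝 (extChartAt (I.tangent.prod 𝓘(ℝ, ℝ)) p p)]
          extForm (formInChart I η p.1.proj) := by
    intro p
    have h := extChartAt_target_mem_nhds (I := I.tangent.prod 𝓘(ℝ, ℝ)) p
    rw [extChartAt_extended_target] at h
    have h' := mem_of_mem_nhds h
    refine ⟨h', ?_⟩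
    filter_upwards [h] with y hy
    exact hη.1.formInChart_extendedForm p hy
  obtain ⟨n, hn, -⟩ := hη.2
  -- TM × ℝ has dimension 2(2n+1) + 1.
  refine isContactForm_of_isLinContact (n := 2 * n + 1) ?_ ?_ fun p ↦ ?_
  · refine isSmoothForm_of_contDiffAt fun p ↦ ?_
    exact (contDiffAt_extForm (hη.1.contDiffAt_formInChart (hloc p).1)).congr_of_eventuallyEq
      (hloc p).2
  · rw [Module.finrank_prod, Module.finrank_prod, hn, Module.finrank_self]
    ring
  · rw [dval_eq_dForm, dForm_congr (hloc p).2, ← formInChart_self, (hloc p).2.self_of_nhds]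
    exact isLinContact_extForm (hη.1.contDiffAt_formInChart (hloc p).1)
      (hη.isLinContact_formInChart (hloc p).1)

end ExtendedForm

/-! ### Hamiltonian vector fields and contact complements -/

section Hamiltonian

variable {E : Type*} [NormedAddCommGroup E] [NormedSpace ℝ E]
  {H : Type*} [TopologicalSpace H] {I : ModelWithCorners ℝ E H}
  {M : Type*} [TopologicalSpace M] [ChartedSpace H M]

set_option synthInstance.maxHeartbeats 200000 in
theorem contDiffAt_dForm {α : E → E →L[ℝ] ℝ} {y : E} (hα : ContDiffAt ℝ ∞ α y) :
    ContDiffAt ℝ ∞ (dForm α) y := by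
  have hα' : ContDiffAt ℝ ∞ (fderiv ℝ α) y := hα.fderiv_right (by simp)
  have hflip : IsBoundedLinearMap ℝ (fun B : E →L[ℝ] E →L[ℝ] ℝ ↦ B.flip) :=
    ⟨⟨fun _ _ ↦ rfl, fun _ _ ↦ rfl⟩, 1, one_pos, fun B ↦ by
      rw [ContinuousLinearMap.opNorm_flip, one_mul]⟩
  have hc : ContDiff ℝ ∞ (fun B : E →L[ℝ] E →L[ℝ] ℝ ↦ B.flip) := hflip.contDiff
  exact hα'.sub (ContDiffAt.comp (g := fun B : E →L[ℝ] E →L[ℝ] ℝ ↦ B.flip) y hc.contDiffAt hα')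

/-- The value of a vector field, as a vector of the model space. -/
def VectorField.val (X : VectorField I M) (x : M) : E := X x

/-- The expression of a vector field in the preferred chart around `x₀`. -/
def fieldInChart (X : VectorField I M) (x₀ : M) (y : E) : E :=
  tderiv I 𝓘(ℝ, E) (extChartAt I x₀) ((extChartAt I x₀).symm y)
    (VectorField.val X ((extChartAt I x₀).symm y))

/-- The value of `♯_Λ`, as a map between the model spaces. -/
def sharpVal (η : OneForm I M) (x : M) (α : E →L[ℝ] ℝ) : E := sharpLambda I η x α

/-- The function `η(X)`. -/
def evalField (η : OneForm I M) (X : VectorField I M) (x : M) : ℝ := η x (X x)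

theorem evalField_eq (η : OneForm I M) (X : VectorField I M) (x : M) :
    evalField η X x = OneForm.val η x (VectorField.val X x) := rfl

theorem contMDiff_of_eventuallyEq_chart {f : M → ℝ} (F : M → E → ℝ)
    (hF : ∀ x₀, ContDiffAt ℝ ∞ (F x₀) (extChartAt I x₀ x₀))
    (h : ∀ x₀, ∀ x ∈ (extChartAt I x₀).source, f x = F x₀ (extChartAt I x₀ x)) :
    ContMDiff I 𝓘(ℝ, ℝ) ∞ f := by
  intro x₀
  refine ((hF x₀).contMDiffAt.comp x₀ contMDiffAt_extChartAt).congr_of_eventuallyEq ?_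
  filter_upwards [extChartAt_source_mem_nhds (I := I) x₀] with x hx
  exact h x₀ x hx

variable [I.Boundaryless] [IsManifold I ∞ M]

theorem IsSmoothField.contDiffAt_fieldInChart {X : VectorField I M} (hX : IsSmoothField I X)
    {x₀ : M} {y : E} (hy : y ∈ (extChartAt I x₀).target) :
    ContDiffAt ℝ ∞ (fieldInChart X x₀) y := by
  have hx := (extChartAt I x₀).map_target hy
  have h1 := ((trivializationAt E (TangentSpace I : M → Type _) x₀).contMDiffAt_section_iff
    (by simpa using hx)).1 (hX ((extChartAt I x₀).symm y))
  have h2 := (h1.comp y (contMDiffAt_extChartAt_symm hy)).contDiffAt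
  refine h2.congr_of_eventuallyEq ?_
  filter_upwards [(isOpen_extChartAt_target x₀).mem_nhds hy] with z hz
  exact (trivializationAt_tangent_snd ((extChartAt I x₀).map_target hz) _).symm

theorem evalField_eq_formInChart (η : OneForm I M) (X : VectorField I M) {x₀ x : M}
    (hx : x ∈ (extChartAt I x₀).source) : evalField η X x =
      formInChart I η x₀ (extChartAt I x₀ x) (fieldInChart X x₀ (extChartAt I x₀ x)) := by
  rw [fieldInChart, (extChartAt I x₀).left_inv hx]
  exact (congrArg (fun f : E →L[ℝ] ℝ ↦ f (VectorField.val X x))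
    (formInChart_comp_tderiv η hx)).symm

theorem contMDiff_evalField {η : OneForm I M} (hη : IsSmoothForm I η) {X : VectorField I M}
    (hX : IsSmoothField I X) : ContMDiff I 𝓘(ℝ, ℝ) ∞ (evalField η X) := by
  refine contMDiff_of_eventuallyEq_chart (I := I)
    (fun x₀ y ↦ formInChart I η x₀ y (fieldInChart X x₀ y)) (fun x₀ ↦ ?_)
    fun x₀ x hx ↦ evalField_eq_formInChart η X hx
  have h := mem_extChartAt_target (I := I) x₀
  exact (hη.contDiffAt_formInChart h).clm_apply (hX.contDiffAt_fieldInChart h)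

variable [FiniteDimensional ℝ E]

theorem IsContactForm.reeb_spec {η : OneForm I M} (hη : IsContactForm I η) (x : M) :
    OneForm.val η x (VectorField.val (reeb I η) x) = 1 ∧
      ∀ w : E, OneForm.dval η x (VectorField.val (reeb I η) x) w = 0 :=
  Classical.epsilon_spec (p := fun R : TangentSpace I x ↦
    η x R = 1 ∧ ∀ w : TangentSpace I x, extDerivForm I η x R w = 0)
    (hη.isLinContact x).exists_reeb

theorem IsContactForm.eq_sharpLambda_iff {η : OneForm I M} (hη : IsContactForm I η) (x : M)
    (α : E →L[ℝ] ℝ) (u : E) :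
    u = sharpVal η x α ↔ OneForm.val η x u = 0 ∧ ∀ w, OneForm.dval η x u w =
      α w - α (VectorField.val (reeb I η) x) * OneForm.val η x w  := by
  have h := (hη.isLinContact x).sharpLambda_spec (hη.reeb_spec x).1 (hη.reeb_spec x).2 α u
  exact h

/-- The equation is rewritten as X + F R = ♯_Λ(dF), to which the characterization of ♯_Λ applies; F
R adds F to the value of η and nothing to dη(X, ·). -/
theorem IsContactForm.eq_hamiltonianField_iff {η : OneForm I M} (hη : IsContactForm I η)
    (X : VectorField I M) (F : M → ℝ) (x : M) :
    X x = hamiltonianField I η F x ↔ OneForm.val η x (VectorField.val X x) = -F x ∧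
      ∀ w, OneForm.dval η x (VectorField.val X x) w = tderiv I 𝓘(ℝ, ℝ) F x w -
        tderiv I 𝓘(ℝ, ℝ) F x (VectorField.val (reeb I η) x) * OneForm.val η x w := by
  have h1 : X x = hamiltonianField I η F x ↔
      VectorField.val X x + F x • VectorField.val (reeb I η) x =
        sharpVal η x (tderiv I 𝓘(ℝ, ℝ) F x) :=
    eq_sub_iff_add_eq
  rw [h1, hη.eq_sharpLambda_iff, map_add, map_smul, (hη.reeb_spec x).1, smul_eq_mul, mul_one,
    eq_neg_iff_add_eq_zero]
  simp [(hη.reeb_spec x).2]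

/-- `X` is Hamiltonian if and only if `L_X η = R(η(X)) η`. -/
theorem IsContactForm.isHamiltonianField_iff {η : OneForm I M} (hη : IsContactForm I η)
    {X : VectorField I M} (hX : IsSmoothField I X) :
    IsHamiltonianField I η X ↔ ∀ (x : M) (w : E), tderiv I 𝓘(ℝ, ℝ) (evalField η X) x w +
      OneForm.dval η x (VectorField.val X x) w =
        tderiv I 𝓘(ℝ, ℝ) (evalField η X) x (VectorField.val (reeb I η) x) *
          OneForm.val η x w := by
  have hneg : ∀ x, tderiv I 𝓘(ℝ, ℝ) (-evalField η X) x = -tderiv I 𝓘(ℝ, ℝ) (evalField η X) x :=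
    fun _ ↦ mfderiv_neg
  constructor
  · rintro ⟨F, -, hXF⟩ x w
    have h := fun x ↦ (hη.eq_hamiltonianField_iff X F x).1 (congrFun hXF x)
    -- The Hamiltonian function is determined by the field.
    have hF : F = -evalField η X := by
      funext z
      rw [Pi.neg_apply, evalField_eq, (h z).1, neg_neg]
    rw [(h x).2 w, hF, hneg]
    simp
  · intro h
    refine ⟨-evalField η X, (contMDiff_evalField hη.1 hX).neg, funext fun x ↦ ?_⟩
    rw [hη.eq_hamiltonianField_iff]
    refine ⟨by rw [Pi.neg_apply, neg_neg, evalField_eq], fun w ↦ ?_⟩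
    have := h x w
    rw [hneg]
    simp only [neg_apply]
    linarith

/-- The Reeb vector field in a chart, as the image of `α` under the inverse of `♭`. -/
theorem IsContactForm.tderiv_reeb {η : OneForm I M} (hη : IsContactForm I η) {x₀ x : M}
    (hx : x ∈ (extChartAt I x₀).source) :
    tderiv I 𝓘(ℝ, E) (extChartAt I x₀) x (VectorField.val (reeb I η) x) =
      (dForm (formInChart I η x₀) (extChartAt I x₀ x) +
        (formInChart I η x₀ (extChartAt I x₀ x)).smulRight
          (formInChart I η x₀ (extChartAt I x₀ x))).inverse
            (formInChart I η x₀ (extChartAt I x₀ x)) := by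
  have hy := (extChartAt I x₀).map_source hx
  have hlin := hη.isLinContact_formInChart hy
  have h1 : formInChart I η x₀ (extChartAt I x₀ x)
      (tderiv I 𝓘(ℝ, E) (extChartAt I x₀) x (VectorField.val (reeb I η) x)) = 1 :=
    (congrArg (fun f : E →L[ℝ] ℝ ↦ f (VectorField.val (reeb I η) x))
      (formInChart_comp_tderiv η hx)).trans (hη.reeb_spec x).1
  have h2 : ∀ w, dForm (formInChart I η x₀) (extChartAt I x₀ x)
      (tderiv I 𝓘(ℝ, E) (extChartAt I x₀) x (VectorField.val (reeb I η) x)) w = 0 := by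
    intro w
    have h3 := congrArg (fun f : E →L[ℝ] E ↦ f (VectorField.val (reeb I η) x))
      (tderiv_symm_comp_tderiv hx)
    simp only [ContinuousLinearMap.comp_apply, ContinuousLinearMap.id_apply] at h3
    rw [hη.1.dForm_formInChart hy, h3, (extChartAt I x₀).left_inv hx]
    exact (hη.reeb_spec x).2 _
  symm
  rw [hlin.isInvertible_flat.inverse_apply_eq]
  refine ContinuousLinearMap.ext fun w ↦ ?_
  rw [add_apply, add_apply, h2, ContinuousLinearMap.smulRight_apply, h1]
  simp

/-- The function `-R(η(X))` is smooth. -/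
theorem IsContactForm.contMDiff_dirDeriv_reeb {η : OneForm I M} (hη : IsContactForm I η)
    {f : M → ℝ} (hf : ContMDiff I 𝓘(ℝ, ℝ) ∞ f) :
    ContMDiff I 𝓘(ℝ, ℝ) ∞ (dirDeriv I (reeb I η) f) := by
  have : CompleteSpace E := FiniteDimensional.complete ℝ E
  have hloc : ∀ {x₀ : M} {y : E}, y ∈ (extChartAt I x₀).target →
      ContDiffAt ℝ ∞ (f ∘ (extChartAt I x₀).symm) y := fun hy ↦
    (hf.contMDiffAt.comp _ (contMDiffAt_extChartAt_symm hy)).contDiffAt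
  refine contMDiff_of_eventuallyEq_chart (I := I)
    (fun x₀ y ↦ fderiv ℝ (f ∘ (extChartAt I x₀).symm) y
      ((dForm (formInChart I η x₀) y +
        (formInChart I η x₀ y).smulRight (formInChart I η x₀ y)).inverse
          (formInChart I η x₀ y))) (fun x₀ ↦ ?_) fun x₀ x hx ↦ ?_
  · have hy := mem_extChartAt_target (I := I) x₀
    have hα := hη.1.contDiffAt_formInChart hy
    have hd := contDiffAt_dForm hα
    have hflat : ContDiffAt ℝ ∞ (fun y ↦ dForm (formInChart I η x₀) y +
        (formInChart I η x₀ y).smulRight (formInChart I η x₀ y)) (extChartAt I x₀ x₀) :=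
      hd.add (hα.smulRight hα)
    -- In a chart R is ♭⁻¹ applied to the form, and inversion is smooth at invertible maps.
    have hinv := ContDiffAt.comp (g := ContinuousLinearMap.inverse) (extChartAt I x₀ x₀)
      (hη.isLinContact_formInChart hy).isInvertible_flat.contDiffAt_map_inverse hflat
    exact ((hloc hy).fderiv_right (m := ∞) (by simp)).clm_apply (hinv.clm_apply hα)
  · have hy := (extChartAt I x₀).map_source hx
    have hfd : MDifferentiableAt I 𝓘(ℝ, ℝ) f ((extChartAt I x₀).symm (extChartAt I x₀ x)) :=
      hf.mdifferentiableAt (by simp)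
    have h3 := congrArg (fun f : E →L[ℝ] E ↦ f (VectorField.val (reeb I η) x))
      (tderiv_symm_comp_tderiv hx)
    simp only [ContinuousLinearMap.comp_apply, ContinuousLinearMap.id_apply] at h3
    rw [← hη.tderiv_reeb hx, ← tderiv_eq_fderiv,
      tderiv_comp hfd (mdifferentiableAt_extChartAt_symm hy), ContinuousLinearMap.comp_apply, h3,
      (extChartAt I x₀).left_inv hx]
    rfl

theorem IsContactForm.contMDiff_extendedField {η : OneForm I M} (hη : IsContactForm I η)
    {X : VectorField I M} (hX : IsSmoothField I X) :
    ContMDiff I (I.tangent.prod 𝓘(ℝ, ℝ)) ∞ (extendedField I η X) :=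
  ContMDiff.prodMk hX (hη.contMDiff_dirDeriv_reeb (contMDiff_evalField hη.1 hX)).neg

/-- Chain rule for the identity π ∘ X̄ = id; it also makes the differential of X̄ injective. -/
theorem IsContactForm.tderiv_proj_extendedField {η : OneForm I M} (hη : IsContactForm I η)
    {X : VectorField I M} (hX : IsSmoothField I X) (x : M) (w : E) :
    tderiv I.tangent I (fun v : TangentBundle I M ↦ v.proj) (extendedField I η X x).1
      (tderiv (I.tangent.prod 𝓘(ℝ, ℝ)) I.tangent
        (Prod.fst : TangentBundle I M × ℝ → TangentBundle I M) (extendedField I η X x)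
        (tderiv I (I.tangent.prod 𝓘(ℝ, ℝ)) (extendedField I η X) x w)) = w := by
  have hd : MDifferentiableAt I (I.tangent.prod 𝓘(ℝ, ℝ)) (extendedField I η X) x :=
    (hη.contMDiff_extendedField hX).mdifferentiableAt (by simp)
  have h1 := tderiv_comp (mdifferentiableAt_fst_extended _) hd
  have h2 := tderiv_comp (f := Prod.fst ∘ extendedField I η X) (x := x)
    (mdifferentiableAt_tangent_proj _) ((mdifferentiableAt_fst_extended _).comp x hd)
  have h3 : tderiv I I ((fun v : TangentBundle I M ↦ v.proj) ∘ Prod.fst ∘ extendedField I η X) x =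
      ContinuousLinearMap.id ℝ E := mfderiv_id
  rw [h3, h1] at h2
  exact (congrArg (fun f : E →L[ℝ] E ↦ f w) h2).symm

/-- The pullback of `η^c + t η^v` by `X × (-R(η(X)))` is `L_X η - R(η(X)) η`. -/
theorem IsContactForm.val_extendedForm_extendedField {η : OneForm I M} (hη : IsContactForm I η)
    {X : VectorField I M} (hX : IsSmoothField I X) (x : M) (w : E) :
    OneForm.val (I := I.tangent.prod 𝓘(ℝ, ℝ)) (extendedForm I η) (extendedField I η X x)
        (tderiv I (I.tangent.prod 𝓘(ℝ, ℝ)) (extendedField I η X) x w) =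
      tderiv I 𝓘(ℝ, ℝ) (evalField η X) x w + OneForm.dval η x (VectorField.val X x) w -
        tderiv I 𝓘(ℝ, ℝ) (evalField η X) x (VectorField.val (reeb I η) x) *
          OneForm.val η x w := by
  have hd : MDifferentiableAt I (I.tangent.prod 𝓘(ℝ, ℝ)) (extendedField I η X) x :=
    (hη.contMDiff_extendedField hX).mdifferentiableAt (by simp)
  rw [val_extendedForm_apply η (extendedField I η X x) _ rfl
    (hη.tderiv_proj_extendedField hX x w).symm]
  have h1 := tderiv_comp (mdifferentiableAt_fst_extended _) hd
  have h2 := tderiv_comp (f := Prod.fst ∘ extendedField I η X) (x := x)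
    (hη.1.mdifferentiableAt_eval _) ((mdifferentiableAt_fst_extended _).comp x hd)
  rw [h1] at h2
  have h3 := congrArg (fun f : E →L[ℝ] ℝ ↦ f w) h2
  -- The composite of v ↦ η(v) with X is η(X); the last term of the formula comes from t = -R(η(X))
  -- along the image.
  have h4 : tderiv I 𝓘(ℝ, ℝ) (evalField η X) x w = _ := h3
  rw [h4, sub_eq_add_neg, ← neg_mul]
  rfl

theorem IsContactForm.isHamiltonianField_iff_pullback_eq_zero {η : OneForm I M}
    (hη : IsContactForm I η) {X : VectorField I M} (hX : IsSmoothField I X) :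
    IsHamiltonianField I η X ↔ ∀ (x : M) (w : E),
      OneForm.val (I := I.tangent.prod 𝓘(ℝ, ℝ)) (extendedForm I η) (extendedField I η X x)
        (tderiv I (I.tangent.prod 𝓘(ℝ, ℝ)) (extendedField I η X) x w) = 0 := by
  rw [hη.isHamiltonianField_iff hX]
  simp only [hη.val_extendedForm_extendedField hX, sub_eq_zero]

theorem IsContactForm.val_eq_zero_of_mem_contactComplement {η : OneForm I M}
    (hη : IsContactForm I η) {x : M} {Δ : Set E} {u : E}
    (hu : u ∈ (contactComplement I η x Δ : Set E)) : OneForm.val η x u = 0 := by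
  obtain ⟨α, -, hα⟩ := hu
  exact ((hη.eq_sharpLambda_iff x α u).1 hα.symm).1

/-- An isotropic subspace of half the maximal dimension is equal to its contact complement. -/
theorem IsContactForm.contactComplement_eq {η : OneForm I M} (hη : IsContactForm I η) {x : M}
    {n : ℕ} (hn : Module.finrank ℝ E = 2 * n + 1) (Δ : Submodule ℝ E) {S : Set E} (hS : S = Δ)
    (hΔ : Module.finrank ℝ Δ = n) (ha : ∀ v ∈ Δ, OneForm.val η x v = 0)
    (hb : ∀ v ∈ Δ, ∀ w ∈ Δ, OneForm.dval η x v w = 0) :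
    (contactComplement I η x S : Set E) = S := by
  subst hS
  have hlin := hη.isLinContact x
  refine Set.ext (α := E) fun u ↦ ?_
  constructor
  · rintro ⟨α, hα0, hα⟩
    have h := (hη.eq_sharpLambda_iff x α u).1 hα.symm
    refine hlin.mem_of_isotropic hn Δ hΔ ha hb h.1 fun w hw ↦ ?_
    have hαw : (show E →L[ℝ] ℝ from α) w = 0 := hα0 w hw
    rw [h.2 w, ha w hw, mul_zero, sub_zero]
    exact hαw
  · intro hu
    -- The covector dη(u, ·) annihilates Δ by isotropy and vanishes on R, so ♯_Λ sends it to u.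
    refine ⟨OneForm.dval η x u, fun w hw ↦ hb u hu w hw, ?_⟩
    refine ((hη.eq_sharpLambda_iff x (OneForm.dval η x u) u).2 ⟨ha u hu, fun w ↦ ?_⟩).symm
    rw [hlin.right_reeb (hη.reeb_spec x).2, zero_mul, sub_zero]

end Hamiltonian

/-! ### The image of a section as a submanifold -/

section Shear

variable {E : Type*} [NormedAddCommGroup E] [NormedSpace ℝ E]

/-- The shear `((x, w), t) ↦ ((x, w - h(x)), t - k(x))` over an open set. -/
def shear {U : Set E} (hU : IsOpen U) {h : E → E} {k : E → ℝ} (hh : ContinuousOn h U)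
    (hk : ContinuousOn k U) :
    OpenPartialHomeomorph (ModelProd (ModelProd E E) ℝ) (ModelProd (ModelProd E E) ℝ) where
  toFun z := ((z.1.1, z.1.2 - h z.1.1), z.2 - k z.1.1)
  invFun z := ((z.1.1, z.1.2 + h z.1.1), z.2 + k z.1.1)
  source := {z | z.1.1 ∈ U}
  target := {z | z.1.1 ∈ U}
  map_source' _ hz := hz
  map_target' _ hz := hz
  left_inv' z _ := Prod.ext (Prod.ext rfl (sub_add_cancel _ _)) (sub_add_cancel _ _)
  right_inv' z _ := Prod.ext (Prod.ext rfl (add_sub_cancel_right _ _)) (add_sub_cancel_right _ _)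
  open_source := hU.preimage (continuous_fst.comp continuous_fst)
  open_target := hU.preimage (continuous_fst.comp continuous_fst)
  continuousOn_toFun := by
    have h1 : ContinuousOn (fun z : (E × E) × ℝ ↦ z.1.1) {z | z.1.1 ∈ U} := by fun_prop
    have h2 : ContinuousOn (fun z : (E × E) × ℝ ↦ z.1.2) {z | z.1.1 ∈ U} := by fun_prop
    have h3 : ContinuousOn (fun z : (E × E) × ℝ ↦ z.2) {z | z.1.1 ∈ U} := by fun_prop
    exact (h1.prodMk (h2.sub (hh.comp h1 fun _ hz ↦ hz))).prodMk
      (h3.sub (hk.comp h1 fun _ hz ↦ hz))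
  continuousOn_invFun := by
    have h1 : ContinuousOn (fun z : (E × E) × ℝ ↦ z.1.1) {z | z.1.1 ∈ U} := by fun_prop
    have h2 : ContinuousOn (fun z : (E × E) × ℝ ↦ z.1.2) {z | z.1.1 ∈ U} := by fun_prop
    have h3 : ContinuousOn (fun z : (E × E) × ℝ ↦ z.2) {z | z.1.1 ∈ U} := by fun_prop
    exact (h1.prodMk (h2.add (hh.comp h1 fun _ hz ↦ hz))).prodMk
      (h3.add (hk.comp h1 fun _ hz ↦ hz))

theorem shear_mem_contDiffGroupoid {U : Set E} (hU : IsOpen U) {h : E → E} {k : E → ℝ}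
    (hh : ContDiffOn ℝ ∞ h U) (hk : ContDiffOn ℝ ∞ k U) :
    shear hU hh.continuousOn hk.continuousOn ∈
      contDiffGroupoid ∞ (𝓘(ℝ, E).tangent.prod 𝓘(ℝ, ℝ)) := by
  have h1 : ContDiffOn ℝ ∞ (fun z : (E × E) × ℝ ↦ z.1.1) {z | z.1.1 ∈ U} := by fun_prop
  have h2 : ContDiffOn ℝ ∞ (fun z : (E × E) × ℝ ↦ z.1.2) {z | z.1.1 ∈ U} := by fun_prop
  have h3 : ContDiffOn ℝ ∞ (fun z : (E × E) × ℝ ↦ z.2) {z | z.1.1 ∈ U} := by fun_prop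
  have e1 : ContDiffOn ℝ ∞ (fun z : (E × E) × ℝ ↦ ((z.1.1, z.1.2 - h z.1.1), z.2 - k z.1.1))
      {z | z.1.1 ∈ U} :=
    (h1.prodMk (h2.sub (hh.comp h1 fun _ hz ↦ hz))).prodMk (h3.sub (hk.comp h1 fun _ hz ↦ hz))
  have e2 : ContDiffOn ℝ ∞ (fun z : (E × E) × ℝ ↦ ((z.1.1, z.1.2 + h z.1.1), z.2 + k z.1.1))
      {z | z.1.1 ∈ U} :=
    (h1.prodMk (h2.add (hh.comp h1 fun _ hz ↦ hz))).prodMk (h3.add (hk.comp h1 fun _ hz ↦ hz))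
  exact ⟨e1.mono inter_subset_left, e2.mono inter_subset_left⟩

theorem trans_mem_maximalAtlas {H : Type*} [TopologicalSpace H] {M : Type*} [TopologicalSpace M]
    [ChartedSpace H M] {G : StructureGroupoid H} [HasGroupoid M G] {e : OpenPartialHomeomorph M H}
    (he : e ∈ G.maximalAtlas M) {s : OpenPartialHomeomorph H H} (hs : s ∈ G) :
    e ≫ₕ s ∈ G.maximalAtlas M := by
  rw [mem_maximalAtlas_iff] at he ⊢
  intro e' he'
  obtain ⟨h1, h2⟩ := he e' he'
  rw [OpenPartialHomeomorph.trans_symm_eq_symm_trans_symm, OpenPartialHomeomorph.trans_assoc,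
    ← OpenPartialHomeomorph.trans_assoc e'.symm]
  exact ⟨G.trans (G.symm hs) h1, G.trans h2 hs⟩

end Shear

section Section

variable {E : Type*} [NormedAddCommGroup E] [NormedSpace ℝ E]
  {M : Type*} [TopologicalSpace M] [ChartedSpace E M] [IsManifold 𝓘(ℝ, E) ∞ M]

/-- The preferred chart followed by the shear along the local expressions of X and f straightens the
section to the subspace where the last two coordinates vanish. The shear is a diffeomorphism, so the
composite belongs to the maximal atlas. -/
theorem isSubmanifold_range_section {X : VectorField 𝓘(ℝ, E) M} (hX : IsSmoothField 𝓘(ℝ, E) X)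
    {f : M → ℝ} (hf : ContMDiff 𝓘(ℝ, E) 𝓘(ℝ, ℝ) ∞ f) :
    IsSubmanifold (𝓘(ℝ, E).tangent.prod 𝓘(ℝ, ℝ))
      (range fun x ↦ ((⟨x, X x⟩, f x) : TangentBundle 𝓘(ℝ, E) M × ℝ)) := by
  rintro _ ⟨x₀, rfl⟩
  set p : TangentBundle 𝓘(ℝ, E) M × ℝ := (⟨x₀, X x₀⟩, f x₀) with hp
  have hU : IsOpen (extChartAt 𝓘(ℝ, E) x₀).target := isOpen_extChartAt_target x₀
  have hh : ContDiffOn ℝ ∞ (fieldInChart X x₀) (extChartAt 𝓘(ℝ, E) x₀).target := fun y hy ↦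
    (hX.contDiffAt_fieldInChart hy).contDiffWithinAt
  have hk : ContDiffOn ℝ ∞ (f ∘ (extChartAt 𝓘(ℝ, E) x₀).symm) (extChartAt 𝓘(ℝ, E) x₀).target :=
    fun y hy ↦ (hf.contMDiffAt.comp y
      (contMDiffAt_extChartAt_symm hy)).contDiffAt.contDiffWithinAt
  let c := chartAt (ModelProd (ModelProd E E) ℝ) p
  let s := shear hU hh.continuousOn hk.continuousOn
  have hmem : ∀ q : TangentBundle 𝓘(ℝ, E) M × ℝ, q ∈ (c ≫ₕ s).source →
      q.1.proj ∈ (extChartAt 𝓘(ℝ, E) x₀).source := by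
    intro q hq
    have h1 : q ∈ (extChartAt (𝓘(ℝ, E).tangent.prod 𝓘(ℝ, ℝ)) p).source := by
      rw [extChartAt_source]
      exact hq.1
    rwa [extChartAt_extended_source] at h1
  have hmem' : ∀ q : TangentBundle 𝓘(ℝ, E) M × ℝ, q.1.proj ∈ (extChartAt 𝓘(ℝ, E) x₀).source →
      q ∈ (c ≫ₕ s).source := by
    intro q hq
    have h1 : q ∈ (extChartAt (𝓘(ℝ, E).tangent.prod 𝓘(ℝ, ℝ)) p).source := by
      rwa [extChartAt_extended_source]
    refine ⟨by rwa [extChartAt_source] at h1, ?_⟩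
    have h2 : ((extChartAt (𝓘(ℝ, E).tangent.prod 𝓘(ℝ, ℝ)) p) q).1.1 ∈
        (extChartAt 𝓘(ℝ, E) x₀).target := by
      rw [extChartAt_extended_apply p hq]
      exact (extChartAt 𝓘(ℝ, E) x₀).map_source hq
    exact h2
  let L : ((E × E) × ℝ) →ₗ[ℝ] E × ℝ :=
    ((LinearMap.snd ℝ E E).comp (LinearMap.fst ℝ (E × E) ℝ)).prod (LinearMap.snd ℝ (E × E) ℝ)
  refine ⟨c ≫ₕ s, trans_mem_maximalAtlas (StructureGroupoid.chart_mem_maximalAtlas _ p)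
    (shear_mem_contDiffGroupoid hU hh hk), hmem' p (mem_extChartAt_source x₀), L.ker, ?_⟩
  rintro ⟨⟨x, v⟩, t⟩ hq
  have hx : x ∈ (extChartAt 𝓘(ℝ, E) x₀).source := hmem _ hq
  have happ : (c ≫ₕ s).extend (𝓘(ℝ, E).tangent.prod 𝓘(ℝ, ℝ)) (⟨x, v⟩, t) =
      ((extChartAt 𝓘(ℝ, E) x₀ x, tderiv 𝓘(ℝ, E) 𝓘(ℝ, E) (extChartAt 𝓘(ℝ, E) x₀) x v -
        fieldInChart X x₀ (extChartAt 𝓘(ℝ, E) x₀ x)),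
        t - f ((extChartAt 𝓘(ℝ, E) x₀).symm (extChartAt 𝓘(ℝ, E) x₀ x))) := by
    have h1 := extChartAt_extended_apply p (q := (⟨x, v⟩, t)) hx
    have h2 : (c ≫ₕ s).extend (𝓘(ℝ, E).tangent.prod 𝓘(ℝ, ℝ)) (⟨x, v⟩, t) =
      s (extChartAt (𝓘(ℝ, E).tangent.prod 𝓘(ℝ, ℝ)) p (⟨x, v⟩, t)) := rfl
    rw [h2, h1]
    rfl
  have hker : (c ≫ₕ s).extend (𝓘(ℝ, E).tangent.prod 𝓘(ℝ, ℝ)) (⟨x, v⟩, t) ∈ L.ker ↔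
      tderiv 𝓘(ℝ, E) 𝓘(ℝ, E) (extChartAt 𝓘(ℝ, E) x₀) x v =
        tderiv 𝓘(ℝ, E) 𝓘(ℝ, E) (extChartAt 𝓘(ℝ, E) x₀) x (VectorField.val X x) ∧ t = f x := by
    rw [happ, fieldInChart, (extChartAt 𝓘(ℝ, E) x₀).left_inv hx, LinearMap.mem_ker]
    exact Prod.ext_iff.trans (and_congr sub_eq_zero sub_eq_zero)
  rw [hker]
  constructor
  · rintro ⟨x', hx'⟩
    obtain rfl : x' = x := congrArg (fun q : TangentBundle 𝓘(ℝ, E) M × ℝ ↦ q.1.proj) hx'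
    simp only [Prod.mk.injEq, TotalSpace.mk_inj] at hx'
    rw [← hx'.1, ← hx'.2]
    exact ⟨rfl, rfl⟩
  · rintro ⟨h1, rfl⟩
    have h2 := congrArg (tderiv 𝓘(ℝ, E) 𝓘(ℝ, E) (extChartAt 𝓘(ℝ, E) x₀).symm
      (extChartAt 𝓘(ℝ, E) x₀ x)) h1
    have h3 : ∀ w : E, tderiv 𝓘(ℝ, E) 𝓘(ℝ, E) (extChartAt 𝓘(ℝ, E) x₀).symm
      (extChartAt 𝓘(ℝ, E) x₀ x) (tderiv 𝓘(ℝ, E) 𝓘(ℝ, E) (extChartAt 𝓘(ℝ, E) x₀) x w) = w :=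
      fun w ↦ congrArg (fun f : E →L[ℝ] E ↦ f w) (tderiv_symm_comp_tderiv hx)
    have h4 : v = X x := (h3 v).symm.trans (h2.trans (h3 _))
    rw [h4]
    exact ⟨x, rfl⟩

end Section

/-! ### Tangent spaces of the image of a section. -/

section Tangent

variable {E : Type*} [NormedAddCommGroup E] [NormedSpace ℝ E]
  {H : Type*} [TopologicalSpace H] {I : ModelWithCorners ℝ E H} [I.Boundaryless]
  {M : Type*} [TopologicalSpace M] [ChartedSpace H M] [IsManifold I ∞ M]
  {E' : Type*} [NormedAddCommGroup E'] [NormedSpace ℝ E']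
  {H' : Type*} [TopologicalSpace H'] {I' : ModelWithCorners ℝ E' H'}
  {M' : Type*} [TopologicalSpace M'] [ChartedSpace H' M']

/-- The tangent space of a submanifold, as a subset of the model space. -/
def tangentSpaceVal (I : ModelWithCorners ℝ E H) (N : Set M) (p : M) : Set E :=
  tangentSpaceOf I N p

/-- The tangent space of the image of a smooth map with a smooth left inverse. -/
theorem tangentSpaceOf_range {f : M → M'} (hf : ContMDiff I I' ∞ f) {r : M' → M}
    (hr : ContMDiff I' I ∞ r) (hrf : ∀ x, r (f x) = x) (x : M) :
    tangentSpaceVal I' (range f) (f x) = LinearMap.range (tderiv I I' f x).toLinearMap := by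
  refine Set.ext (α := E') fun v ↦ ⟨?_, ?_⟩
  · rintro ⟨γ, h0, hγ, hN, hv⟩
    -- The left inverse r turns a curve in the image into a smooth curve in M, whose velocity is the
    -- required preimage.
    have heq : γ =ᶠ[𝓝 0] f ∘ (r ∘ γ) := by
      filter_upwards [hN] with t ht
      obtain ⟨z, hz⟩ := ht
      rw [Function.comp_apply, Function.comp_apply, ← hz, hrf]
    have hγd : MDifferentiableAt 𝓘(ℝ, ℝ) I' γ 0 := hγ.mdifferentiableAt (by simp)
    have hrd : MDifferentiableAt I' I r (γ 0) := hr.mdifferentiableAt (by simp)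
    have hfd : MDifferentiableAt I I' f ((r ∘ γ) 0) := hf.mdifferentiableAt (by simp)
    have h1 : tderiv 𝓘(ℝ, ℝ) I' γ 0 =
        (tderiv I I' f x).comp (tderiv 𝓘(ℝ, ℝ) I (r ∘ γ) 0) := by
      rw [tderiv_congr heq, tderiv_comp hfd (hrd.comp 0 hγd), Function.comp_apply, h0, hrf]
    exact ⟨tderiv 𝓘(ℝ, ℝ) I (r ∘ γ) 0 1,
      (congrArg (fun g : ℝ →L[ℝ] E' ↦ g 1) h1).symm.trans hv⟩
  · rintro ⟨u, rfl⟩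
    set φ := extChartAt I x with hφ
    -- A straight line in the chart at x; its velocity is u in the tangent space, since that chart
    -- has identity differential at x.
    let l : ℝ → E := fun t ↦ φ x + t • u
    have hl0 : l 0 = φ x := by simp [l]
    have hl : ContMDiffAt 𝓘(ℝ, ℝ) 𝓘(ℝ, E) ∞ l 0 := by
      have : ContDiff ℝ ∞ l := contDiff_const.add (contDiff_id.smul contDiff_const)
      exact this.contMDiff.contMDiffAt
    have hl' : HasFDerivAt l ((ContinuousLinearMap.id ℝ ℝ).smulRight u) 0 :=
      ((hasFDerivAt_id (𝕜 := ℝ) (0 : ℝ)).smul_const u).const_add (φ x)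
    have hs : ContMDiffAt 𝓘(ℝ, E) I ∞ φ.symm (l 0) := by
      rw [hl0]
      exact contMDiffAt_extChartAt_symm (mem_extChartAt_target x)
    have hx : φ.symm (l 0) = x := by rw [hl0, hφ, extChartAt_to_inv]
    have hsl : ContMDiffAt 𝓘(ℝ, ℝ) I ∞ (φ.symm ∘ l) 0 := hs.comp 0 hl
    have hγ : ContMDiffAt 𝓘(ℝ, ℝ) I' ∞ (f ∘ (φ.symm ∘ l)) 0 := hf.contMDiffAt.comp 0 hsl
    refine ⟨f ∘ (φ.symm ∘ l), by rw [Function.comp_apply, Function.comp_apply, hx], hγ,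
      Filter.Eventually.of_forall fun t ↦ ⟨_, rfl⟩, ?_⟩
    have hfd : MDifferentiableAt I I' f ((φ.symm ∘ l) 0) := hf.mdifferentiableAt (by simp)
    have h1 : tderiv 𝓘(ℝ, ℝ) I' (f ∘ (φ.symm ∘ l)) 0 1 = tderiv I I' f x u := by
      have hid := tderiv_symm_comp_tderiv (mem_extChartAt_source (I := I) x)
      rw [tderiv_extChartAt_self, ContinuousLinearMap.comp_id] at hid
      rw [tderiv_comp hfd (hsl.mdifferentiableAt (by simp)),
        tderiv_comp (hs.mdifferentiableAt (by simp)) (hl.mdifferentiableAt (by simp)),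
        tderiv_eq_fderiv, hl'.fderiv, Function.comp_apply, hx, hl0, hid]
      simp
    exact h1

end Tangent

/-! ### Legendrian images -/

section Legendrian

variable {E : Type*} [NormedAddCommGroup E] [NormedSpace ℝ E] [FiniteDimensional ℝ E]
  {M : Type*} [TopologicalSpace M] [ChartedSpace E M] [IsManifold 𝓘(ℝ, E) ∞ M]

theorem IsContactForm.tangentSpaceOf_range_extendedField {η : OneForm 𝓘(ℝ, E) M}
    (hη : IsContactForm 𝓘(ℝ, E) η) {X : VectorField 𝓘(ℝ, E) M} (hX : IsSmoothField 𝓘(ℝ, E) X)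
    (x : M) :
    tangentSpaceVal (𝓘(ℝ, E).tangent.prod 𝓘(ℝ, ℝ)) (range (extendedField 𝓘(ℝ, E) η X))
      (extendedField 𝓘(ℝ, E) η X x) = LinearMap.range
        (tderiv 𝓘(ℝ, E) (𝓘(ℝ, E).tangent.prod 𝓘(ℝ, ℝ)) (extendedField 𝓘(ℝ, E) η X)
          x).toLinearMap :=
  tangentSpaceOf_range (r := fun q : TangentBundle 𝓘(ℝ, E) M × ℝ ↦ q.1.proj)
    (hη.contMDiff_extendedField hX)
    ((contMDiff_proj (TangentSpace 𝓘(ℝ, E) : M → Type _)).comp contMDiff_fst) (fun _ ↦ rfl) x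

/-- If `η^c + t η^v` vanishes on the image of `X × (-R(η(X)))`, then so does its derivative. -/
theorem IsContactForm.dval_extendedForm_eq_zero {η : OneForm 𝓘(ℝ, E) M}
    (hη : IsContactForm 𝓘(ℝ, E) η) {X : VectorField 𝓘(ℝ, E) M} (hX : IsSmoothField 𝓘(ℝ, E) X)
    (h : ∀ (x : M) (w : E), OneForm.val (I := 𝓘(ℝ, E).tangent.prod 𝓘(ℝ, ℝ))
      (extendedForm 𝓘(ℝ, E) η) (extendedField 𝓘(ℝ, E) η X x)
        (tderiv 𝓘(ℝ, E) (𝓘(ℝ, E).tangent.prod 𝓘(ℝ, ℝ)) (extendedField 𝓘(ℝ, E) η X) x w) = 0)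
    (x : M) (u v : E) :
    OneForm.dval (I := 𝓘(ℝ, E).tangent.prod 𝓘(ℝ, ℝ)) (extendedForm 𝓘(ℝ, E) η)
      (extendedField 𝓘(ℝ, E) η X x)
      (tderiv 𝓘(ℝ, E) (𝓘(ℝ, E).tangent.prod 𝓘(ℝ, ℝ)) (extendedField 𝓘(ℝ, E) η X) x u)
      (tderiv 𝓘(ℝ, E) (𝓘(ℝ, E).tangent.prod 𝓘(ℝ, ℝ)) (extendedField 𝓘(ℝ, E) η X) x v) = 0 := by
  set J := 𝓘(ℝ, E).tangent.prod 𝓘(ℝ, ℝ)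
  set Xb := extendedField 𝓘(ℝ, E) η X with hXb
  set φ := extChartAt 𝓘(ℝ, E) x with hφ
  have hXs : ContMDiff 𝓘(ℝ, E) J ∞ Xb := hη.contMDiff_extendedField hX
  have hy := mem_extChartAt_target (I := 𝓘(ℝ, E)) x
  have hg : ∀ z ∈ φ.target, ContMDiffAt 𝓘(ℝ, E) J ∞ (Xb ∘ φ.symm) z := fun z hz ↦
    hXs.contMDiffAt.comp z (contMDiffAt_extChartAt_symm hz)
  have htd : ∀ z ∈ φ.target, tderiv 𝓘(ℝ, E) J (Xb ∘ φ.symm) z =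
      (tderiv 𝓘(ℝ, E) J Xb (φ.symm z)).comp (tderiv 𝓘(ℝ, E) 𝓘(ℝ, E) φ.symm z) := fun z hz ↦
    tderiv_comp (hXs.mdifferentiableAt (by simp)) (mdifferentiableAt_extChartAt_symm hz)
  have hsm : IsSmoothForm J (extendedForm 𝓘(ℝ, E) η) := (isContactForm_extendedForm hη).1
  have hd := dForm_pullback_eq_dval hsm (hg _ hy) u v
  have hid := tderiv_symm_comp_tderiv (mem_extChartAt_source (I := 𝓘(ℝ, E)) x)
  rw [tderiv_extChartAt_self, ContinuousLinearMap.comp_id] at hid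
  have hx : φ.symm (φ x) = x := extChartAt_to_inv x
  -- The pullback vanishes on a whole neighbourhood, so its exterior derivative, which is the
  -- pullback of the exterior derivative, is zero.
  have hzero : (fun z ↦ (OneForm.val (I := J) (extendedForm 𝓘(ℝ, E) η) ((Xb ∘ φ.symm) z)).comp
      (tderiv 𝓘(ℝ, E) J (Xb ∘ φ.symm) z)) =ᶠ[𝓝 (φ x)] fun _ ↦ 0 := by
    filter_upwards [extChartAt_target_mem_nhds (I := 𝓘(ℝ, E)) x] with z hz
    refine ContinuousLinearMap.ext fun w ↦ ?_
    rw [htd z hz]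
    exact h _ _
  rw [dForm_congr hzero, htd _ hy, hid, ContinuousLinearMap.comp_id, Function.comp_apply,
    hx] at hd
  rw [← hd, dForm_apply]
  simp

/-- Forward, only the inclusion of contact complements in the kernel of the form is needed.
Backward, the tangent spaces have dimension 2n+1 by injectivity of the differential and are
isotropic for both the form and its derivative. -/
theorem IsContactForm.isLegendrian_range_iff {η : OneForm 𝓘(ℝ, E) M}
    (hη : IsContactForm 𝓘(ℝ, E) η) {X : VectorField 𝓘(ℝ, E) M} (hX : IsSmoothField 𝓘(ℝ, E) X) :
    IsLegendrian (𝓘(ℝ, E).tangent.prod 𝓘(ℝ, ℝ)) (extendedForm 𝓘(ℝ, E) η)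
        (range (extendedField 𝓘(ℝ, E) η X)) ↔
      ∀ (x : M) (w : E), OneForm.val (I := 𝓘(ℝ, E).tangent.prod 𝓘(ℝ, ℝ))
        (extendedForm 𝓘(ℝ, E) η) (extendedField 𝓘(ℝ, E) η X x)
        (tderiv 𝓘(ℝ, E) (𝓘(ℝ, E).tangent.prod 𝓘(ℝ, ℝ)) (extendedField 𝓘(ℝ, E) η X) x w) = 0 := by
  have hcont := isContactForm_extendedForm hη
  have htan := hη.tangentSpaceOf_range_extendedField hX
  constructor
  · rintro ⟨-, hL⟩ x w
    have hw : tderiv 𝓘(ℝ, E) (𝓘(ℝ, E).tangent.prod 𝓘(ℝ, ℝ)) (extendedField 𝓘(ℝ, E) η X) x w ∈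
        tangentSpaceVal (𝓘(ℝ, E).tangent.prod 𝓘(ℝ, ℝ)) (range (extendedField 𝓘(ℝ, E) η X))
          (extendedField 𝓘(ℝ, E) η X x) := by
      rw [htan]
      exact ⟨w, rfl⟩
    rw [tangentSpaceVal, hL _ ⟨x, rfl⟩] at hw
    exact hcont.val_eq_zero_of_mem_contactComplement hw
  · intro h
    refine ⟨isSubmanifold_range_section hX
      (hη.contMDiff_dirDeriv_reeb (contMDiff_evalField hη.1 hX)).neg, ?_⟩
    rintro _ ⟨x, rfl⟩
    obtain ⟨n, hn, -⟩ := hη.2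
    have hinj : Function.Injective (tderiv 𝓘(ℝ, E) (𝓘(ℝ, E).tangent.prod 𝓘(ℝ, ℝ))
        (extendedField 𝓘(ℝ, E) η X) x) := fun u v huv ↦ by
      rw [← hη.tderiv_proj_extendedField hX x u, huv, hη.tderiv_proj_extendedField hX x v]
    refine (hcont.contactComplement_eq (n := 2 * n + 1) ?_ _ (htan x) ?_ ?_ ?_).symm
    · rw [Module.finrank_prod, Module.finrank_prod, hn, Module.finrank_self]
      ring
    · rw [← hn]
      exact LinearMap.finrank_range_of_inj hinj
    · rintro _ ⟨w, rfl⟩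
      exact h x w
    · rintro _ ⟨u, rfl⟩ _ ⟨v, rfl⟩
      exact hη.dval_extendedForm_eq_zero hX h x u v

end Legendrian

end Contact

end

theorem mainTheorem7
    {E : Type*} [NormedAddCommGroup E] [NormedSpace ℝ E] [FiniteDimensional ℝ E]
    {M : Type*} [TopologicalSpace M] [ChartedSpace E M]
    [IsManifold 𝓘(ℝ, E) ∞ M]
    (η : Contact.OneForm 𝓘(ℝ, E) M) (hη : Contact.IsContactForm 𝓘(ℝ, E) η)
    (X : Contact.VectorField 𝓘(ℝ, E) M) (hX : Contact.IsSmoothField 𝓘(ℝ, E) X) :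
    Contact.IsContactForm (𝓘(ℝ, E).tangent.prod 𝓘(ℝ, ℝ)) (Contact.extendedForm 𝓘(ℝ, E) η) ∧
      (Contact.IsHamiltonianField 𝓘(ℝ, E) η X ↔
        Contact.IsLegendrian (𝓘(ℝ, E).tangent.prod 𝓘(ℝ, ℝ)) (Contact.extendedForm 𝓘(ℝ, E) η)
          (Set.range (Contact.extendedField 𝓘(ℝ, E) η X))) :=
  ⟨Contact.isContactForm_extendedForm hη,
    (hη.isHamiltonianField_iff_pullback_eq_zero hX).trans (hη.isLegendrian_range_iff hX).symm⟩
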